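/- **Setting.** Let $(\Omega,\mathcal F,(\mathcal F_t)_{t\ge0},\mathbb P)$ be a filtered probability space with a standard Brownian motion $W$ relative to $(\mathcal F_t)$, and let $T>0$, $\sigma\neq0$, $c_{-1}>0$. Let $\mu(x)=\sum_s a_s x^s$ ($x>0$) be a fractional Laurent polynomial (a finite sum with pairwise distinct real exponents $s$ and real coefficients $a_s$), let $\deg^-(\mu)$ be the smallest $s$ with $a_s\ne0$, and put $\hat\mu(x)=\mu(x)-c_{-1}x^{-1}$. For $M\in\mathbb N$, $M\ge1$, with $h=T/M\in(0,1]$ let $t_n=nh$, and let $\mathcal P_h:(0,\infty)\to(0,\infty)$ be a map. Assume: 1. $X=(X_t)_{t\ge0}$ is a continuous adapted process with $\mathbb P(X_t\in(0,\infty)\ \forall t\ge0)=1$ that solves $X_t=X_0+\int_0^t\mu(X_s)\,ds+\sigma W_t$, $t\ge0$. 2. $\mu$ and $\hat\mu$ are one-sided Lipschitz: there is $L>0$ with $(f(x)-f(y))(x-y)\le L|x-y|^2$ for all $x,y>0$, for $f=\mu$ and for $f=\hat\mu$. 3. For some $p^*\in(2,\infty]$: $\sup_{t\in[0,T]}\mathbb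 E[|X_t|^{-q}]<\infty$ for all finite $q$ with $0<q\le p^*$. 4. There are $m_1,m_2\ge0$ and $C_1>0$, independent of $h$, such that for all $x,y>0$ $$|\mathcal P_h(x)-\mathcal P_h(y)|\le|x-y|,\qquad |\mathcal P_h(x)-x|\le C_1h^2\big(1+|x|^{-m_1}+|x|^{m_2}\big).$$ 5. There is $C_2>0$, independent of $h$, such that for all $x,y>0$ $$|\hat\mu(\mathcal P_h(x))|\le \max\{C_2h^{-1/2},\,C_2|x|\},\qquad |\hat\mu(\mathcal P_h(x))-\hat\mu(\mathcal P_h(y))|\le C_2h^{-1/2}|x-y|.$$ Let $(Y_n)_{n=0}^M$ be the positive solution of the scheme, for $n=0,\dots,M-1$, $$Y_0=X_0,\qquad Y_{n+1}=\mathcal P_h(Y_n)+c_{-1}hY_{n+1}^{-1}+\hat\mu(\mathcal P_h(Y_n))h+\sigma\,(W_{t_{n+1}}-W_{t_n}),$$ and let $$R_{n+1}=X_{t_n}-\mathcal P_h(X_{t_n})+\int_{t_n}^{t_{n+1}}\mu(X_s)\,ds-c_{-1}hX_{t_{n+1}}^{-1}-\hat\mu(\mathcal P_h(X_{t_n}))h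 .$$ **Theorem.** Let $p$ be real with $1\le p\le -\frac{p^*}{2\deg^-(\mu)}\wedge\frac{p^*}{2m_1}$ (where $\frac{p^*}{0}=\infty$). Then there is a constant $C>0$, independent of $h$ (equivalently, of $M$), such that for every admissible $M$ and every decomposition $R_n=R^{(1)}_n+R^{(2)}_n$, $n=1,\dots,M$, into random variables with $R^{(2)}_{n+1}$ integrable and $\mathbb E[R^{(2)}_{n+1}\mid\mathcal F_{t_n}]=0$ for $n=0,\dots,M-1$, $$\mathbb E\Big[\sup_{n=0,\dots,M}|X_{t_n}-Y_n|^{2p}\Big]\le C\Big(\frac1{h^{2p}}\sup_{n=1,\dots,M}\mathbb E\big[|R^{(1)}_n|^{2p}\big]+\frac1{h^{p}}\sup_{n=1,\dots,M}\mathbb E\big[|R^{(2)}_n|^{2p}\big]\Big),$$ where expectations of nonnegative random variables take values in $[0,\infty]$. -/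

import Mathlib

open MeasureTheory ProbabilityTheory
open scoped NNReal ENNReal

namespace AdditiveNoise

noncomputable section

/-- A fractional Laurent polynomial `x ↦ ∑ aₛ xˢ` on `(0, ∞)`: finitely many pairwise different
real exponents `s`, each with a real coefficient `aₛ` (the value of the finitely supported
function at `s`). -/
abbrev FLP : Type := ℝ →₀ ℝ

/-- The value of a fractional Laurent polynomial at `x` (meant for `x > 0`). -/
def FLP.eval (q : FLP) (x : ℝ) : ℝ := q.sum fun s a => a * x ^ s

/-- `deg⁻`: the smallest exponent with a nonzero coefficient (meant for `q ≠ 0`). -/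
def FLP.degMinus (q : FLP) : ℝ := sInf {s : ℝ | q s ≠ 0}

/-- One-sided Lipschitz condition on `(0, ∞)`. -/
def OneSidedLipschitz (f : ℝ → ℝ) : Prop :=
  ∃ L : ℝ, 0 < L ∧ ∀ x y : ℝ, 0 < x → 0 < y → (f x - f y) * (x - y) ≤ L * |x - y| ^ 2

/-- The modified drift `μ̂(x) = μ(x) - c x⁻¹`. -/
def modifiedDrift (μ : FLP) (c : ℝ) (x : ℝ) : ℝ := μ.eval x - c * x⁻¹

/-- The uniform step size `h = T / M`. -/
def stepSize (T : ℝ≥0) (M : ℕ) : ℝ := (T : ℝ) / M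

/-- The grid point `tₙ = n h` with `h = T / M`. -/
def gridPoint (T : ℝ≥0) (M n : ℕ) : ℝ≥0 := n * (T / M)

/-- The numbers `M` of steps that are allowed: `M ≥ 1` and `h = T / M ∈ (0, 1]`. -/
def Admissible (T : ℝ≥0) (M : ℕ) : Prop := 0 < M ∧ stepSize T M ≤ 1

/-- The correction maps `P h : (0, ∞) → (0, ∞)` are contractive, and consistent with exponents
`m₁, m₂`, uniformly in the step size `h`. -/
def CorrectionMap (T : ℝ≥0) (P : ℝ → ℝ → ℝ) (m₁ m₂ : ℝ) : Prop :=
  ∃ C : ℝ, 0 < C ∧ ∀ M : ℕ, Admissible T M →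
    (∀ x : ℝ, 0 < x → 0 < P (stepSize T M) x) ∧
    (∀ x y : ℝ, 0 < x → 0 < y → |P (stepSize T M) x - P (stepSize T M) y| ≤ |x - y|) ∧
    (∀ x : ℝ, 0 < x →
      |P (stepSize T M) x - x| ≤ C * stepSize T M ^ 2 * (1 + |x| ^ (-m₁) + |x| ^ m₂))

/-- The growth and Lipschitz bounds on `g ∘ P h` (used for `g = μ̂`), uniform in `h`. -/
def CorrectedDriftBound (T : ℝ≥0) (P : ℝ → ℝ → ℝ) (g : ℝ → ℝ) : Prop :=
  ∃ C : ℝ, 0 < C ∧ ∀ M : ℕ, Admissible T M →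
    (∀ x : ℝ, 0 < x →
      |g (P (stepSize T M) x)| ≤ max (C * stepSize T M ^ (-(1 / 2) : ℝ)) (C * |x|)) ∧
    (∀ x y : ℝ, 0 < x → 0 < y →
      |g (P (stepSize T M) x) - g (P (stepSize T M) y)|
        ≤ C * stepSize T M ^ (-(1 / 2) : ℝ) * |x - y|)

variable {Ω : Type*} {mΩ : MeasurableSpace Ω}

/-- `W` is a standard Brownian motion relative to the filtration `𝓕`. -/
structure IsBrownianRelative (W : ℝ≥0 → Ω → ℝ) (𝓕 : Filtration ℝ≥0 mΩ) (Pr : Measure Ω) :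
    Prop where
  brownian : IsBrownianReal W Pr
  adapted : Adapted 𝓕 W
  indep : ∀ s t : ℝ≥0, s ≤ t →
    Indep (MeasurableSpace.comap (fun ω => W t ω - W s ω) inferInstance) (𝓕 s) Pr

/-- `X` is a continuous, `𝓕`-adapted process with values in `(0, ∞)` that solves
`dX = b(X) dt + σ dW`. -/
structure IsPositiveSolution (b : ℝ → ℝ) (σ : ℝ) (W X : ℝ≥0 → Ω → ℝ)
    (𝓕 : Filtration ℝ≥0 mΩ) (Pr : Measure Ω) : Prop where
  adapted : Adapted 𝓕 X
  continuous_paths : ∀ᵐ ω ∂Pr, Continuous fun t => X t ω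
  positive : ∀ᵐ ω ∂Pr, ∀ t : ℝ≥0, 0 < X t ω
  equation : ∀ᵐ ω ∂Pr, ∀ t : ℝ≥0,
    X t ω = X 0 ω + (∫ s in (0 : ℝ)..t, b (X s.toNNReal ω)) + σ * W t ω

/-- `sup_{t ∈ [0, T]} 𝔼[|X_t|^{-q}] < ∞` for all finite `0 < q ≤ p*`. -/
def InverseMomentsBounded (T : ℝ≥0) (X : ℝ≥0 → Ω → ℝ) (Pr : Measure Ω) (pstar : ℝ≥0∞) : Prop :=
  ∀ q : ℝ, 0 < q → ENNReal.ofReal q ≤ pstar →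
    (⨆ t ∈ Set.Icc (0 : ℝ≥0) T, ∫⁻ ω, ENNReal.ofReal (|X t ω| ^ (-q)) ∂Pr) < ∞

/-- `Y 0, …, Y M` is the positive numerical solution produced by the scheme
`Y_{n+1} = P_h(Y_n) + c h Y_{n+1}⁻¹ + μ̂(P_h(Y_n)) h + σ (W_{t_{n+1}} - W_{t_n})`, `Y_0 = X_0`. -/
structure IsNumericalSolution (T : ℝ≥0) (M : ℕ) (P : ℝ → ℝ → ℝ) (μ : FLP) (c σ : ℝ)
    (W X : ℝ≥0 → Ω → ℝ) (Pr : Measure Ω) (Y : ℕ → Ω → ℝ) : Prop where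
  initial : ∀ᵐ ω ∂Pr, Y 0 ω = X 0 ω
  positive : ∀ᵐ ω ∂Pr, ∀ n : ℕ, n ≤ M → 0 < Y n ω
  step : ∀ᵐ ω ∂Pr, ∀ n : ℕ, n < M →
    Y (n + 1) ω = P (stepSize T M) (Y n ω) + c * stepSize T M * (Y (n + 1) ω)⁻¹
      + modifiedDrift μ c (P (stepSize T M) (Y n ω)) * stepSize T M
      + σ * (W (gridPoint T M (n + 1)) ω - W (gridPoint T M n) ω)

/-- The local remainder `R_{n+1}` of the exact solution (the argument is `n`). -/
def remainder (T : ℝ≥0) (M : ℕ) (P : ℝ → ℝ → ℝ) (μ : FLP) (c : ℝ)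
    (X : ℝ≥0 → Ω → ℝ) (n : ℕ) (ω : Ω) : ℝ :=
  X (gridPoint T M n) ω - P (stepSize T M) (X (gridPoint T M n) ω)
    + (∫ s in (gridPoint T M n : ℝ)..(gridPoint T M (n + 1) : ℝ), μ.eval (X s.toNNReal ω))
    - c * stepSize T M * (X (gridPoint T M (n + 1)) ω)⁻¹
    - modifiedDrift μ c (P (stepSize T M) (X (gridPoint T M n) ω)) * stepSize T M

/-- A decomposition `R_n = R¹_n + R²_n`, `n = 1, …, M`, of the local remainders in which `R²_{n+1}`
is integrable with `𝔼[R²_{n+1} | 𝓕_{t_n}] = 0`. -/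
structure IsRemainderDecomposition (T : ℝ≥0) (M : ℕ) (P : ℝ → ℝ → ℝ) (μ : FLP) (c : ℝ)
    (X : ℝ≥0 → Ω → ℝ) (𝓕 : Filtration ℝ≥0 mΩ) (Pr : Measure Ω) (R₁ R₂ : ℕ → Ω → ℝ) :
    Prop where
  sum_eq : ∀ n : ℕ, n < M → ∀ᵐ ω ∂Pr,
    remainder T M P μ c X n ω = R₁ (n + 1) ω + R₂ (n + 1) ω
  integrable : ∀ n : ℕ, n < M → Integrable (R₂ (n + 1)) Pr
  condExp_eq_zero : ∀ n : ℕ, n < M → Pr[R₂ (n + 1) | 𝓕 (gridPoint T M n)] =ᵐ[Pr] 0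

end

end AdditiveNoise

/-!
Let `e n = X_{t_n} - Y_n`, let `R_{n+1} = R₁ + R₂` be the remainder and let
`A n = P_h(X_{t_n}) - P_h(Y_n) + h (μ̂(P_h(X_{t_n})) - μ̂(P_h(Y_n)))`.
Since `x ↦ -x⁻¹` is increasing, the implicit term can only shrink the error, so that
`e (n + 1) ^ 2 ≤ (A n + R₁ + R₂) ^ 2` (`sq_sub_le_of_implicit`). The contractivity of `P_h`, the
one-sided Lipschitz condition on `μ̂` and the `h ^ (-1/2)`-Lipschitz bound on `μ̂ ∘ P_h` give
`A n ^ 2 ≤ (1 + κ h) e n ^ 2` (`sq_explicit_le`).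

Unrolling this recursion bounds `e n ^ 2` by `h⁻¹ ∑ R₁ ^ 2 + ∑ R₂ ^ 2` plus a weighted martingale sum
`∑ A k R₂`. With the running maximum `a k = maxⱼ≤ₖ |e j|` the latter is `∑ a k (K (k + 1) - K k)`,
where the martingale `K` has increments `b k R₂` with bounded predictable weights `b k = O(1)`.
Summation by parts bounds it by `2 a · max |K|`, and Young's inequality absorbs `a` into the left-hand
side. The result is a pathwise bound of `max |e| ^ 2` by `max |K| ^ 2`, `h⁻¹ ∑ R₁ ^ 2` and `∑ R₂ ^ 2`
(`sq_partialSups_abs_le`); it needs no integrability of `e` and no Burkholder–Davis–Gundy inequality.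

For `max |K|`, Doob's `L²` inequality for `|K| ^ p` (`integral_sq_partialSups_le`, again from a
pathwise inequality) reduces matters to `𝔼 |K_M| ^ (2 p)`, and the Taylor estimate for `|·| ^ (2 p)`
with Gronwall's inequality bounds this by a multiple of `h ^ (-p) sup 𝔼 |R₂| ^ (2 p)`
(`integral_abs_sum_rpow_le`).

The given `R₂ (n + 1)` has conditional mean zero given `𝓕_{t_n}`, but it need not be
`𝓕_{t_{n+1}}`-measurable, so that its sums need not form a martingale. The remainder itself is
`𝓕_{t_{n+1}}`-measurable, hence `R₁` and `R₂` may be replaced by their conditional expectations given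
`𝓕_{t_{n+1}}`, which have the same sum and no larger moments.
-/

namespace AdditiveNoise

/-! ### Deterministic inequalities -/

theorem rpow_mul_rpow_le_add {u v a b : ℝ} (hu : 0 ≤ u) (hv : 0 ≤ v) (ha : 0 ≤ a) (hb : 0 ≤ b) :
    u ^ a * v ^ b ≤ u ^ (a + b) + v ^ (a + b) := by
  rcases le_total u v with h | h
  · calc u ^ a * v ^ b ≤ v ^ a * v ^ b := by gcongr
      _ = v ^ (a + b) := (Real.rpow_add_of_nonneg hv ha hb).symm
      _ ≤ _ := le_add_of_nonneg_left (by positivity)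
  · calc u ^ a * v ^ b ≤ u ^ a * u ^ b := by gcongr
      _ = u ^ (a + b) := (Real.rpow_add_of_nonneg hu ha hb).symm
      _ ≤ _ := le_add_of_nonneg_right (by positivity)

theorem one_add_mul_le_abs_rpow {q : ℝ} (hq : 1 ≤ q) (t : ℝ) : 1 + q * (t - 1) ≤ |t| ^ q := by
  rcases le_or_gt 0 t with h | h
  · rw [abs_of_nonneg h]
    have := one_add_mul_self_le_rpow_one_add (s := t - 1) (by linarith) hq
    rwa [add_sub_cancel] at this
  · have : 0 ≤ |t| ^ q := by positivity
    nlinarith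

theorem abs_rpow_sub_two_mul_self_mul (q a : ℝ) (ha : a ≠ 0) :
    |a| ^ (q - 2) * a * a = |a| ^ q := by
  have h : 0 < |a| := abs_pos.2 ha
  rw [mul_assoc, ← abs_mul_abs_self a, ← pow_two, ← Real.rpow_natCast, ← Real.rpow_add h]
  norm_num

/-- The tangent line of the convex function `|·| ^ q` at `a` lies below its graph. For `q = 1` the
factor `|a| ^ (q - 2) * a` is the sign of `a`. -/
theorem abs_rpow_tangent_le {q : ℝ} (hq : 1 ≤ q) (a b : ℝ) :
    |a| ^ q + q * (|a| ^ (q - 2) * a) * (b - a) ≤ |b| ^ q := by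
  rcases eq_or_ne a 0 with rfl | ha
  · simp only [abs_zero, mul_zero, zero_mul, add_zero]
    rw [Real.zero_rpow (by linarith)]
    positivity
  · obtain ⟨t, rfl⟩ : ∃ t, b = a * t := ⟨b / a, by field_simp⟩
    have h1 := one_add_mul_le_abs_rpow hq t
    have h2 := abs_rpow_sub_two_mul_self_mul q a ha
    have h3 : 0 ≤ |a| ^ q := by positivity
    rw [abs_mul, Real.mul_rpow (abs_nonneg _) (abs_nonneg _)]
    calc _ = |a| ^ q + q * (|a| ^ (q - 2) * a * a) * (t - 1) := by ring
      _ = |a| ^ q * (1 + q * (t - 1)) := by rw [h2]; ring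
      _ ≤ _ := by gcongr

theorem abs_one_add_rpow_le {r : ℝ} (hr : 2 ≤ r) (t : ℝ) :
    |1 + t| ^ r ≤ 1 + r * t + r * r * 2 ^ r * (t ^ 2 + |t| ^ r) := by
  have hp2 : (2 : ℝ) ^ (2 : ℝ) ≤ 2 ^ r := Real.rpow_le_rpow_of_exponent_le (by norm_num) hr
  norm_num at hp2
  have hrr : 4 ≤ r * r := by nlinarith
  have hC : 4 * 2 ^ r ≤ r * r * 2 ^ r := by gcongr
  have hC2 : r * r * 4 ≤ r * r * 2 ^ r := by gcongr
  have htr : 0 ≤ |t| ^ r := by positivity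
  rcases le_or_gt 1 |t| with h | h
  · have h1 : |1 + t| ≤ 2 * |t| := (abs_add_le 1 t).trans (by rw [abs_one]; linarith)
    have h2 : |1 + t| ^ r ≤ 2 ^ r * |t| ^ r := by
      rw [← Real.mul_rpow (by norm_num) (abs_nonneg _)]
      gcongr
    have h3 : |t| ≤ |t| ^ r := by
      calc |t| = |t| ^ (1 : ℝ) := (Real.rpow_one _).symm
        _ ≤ _ := Real.rpow_le_rpow_of_exponent_le h (by linarith)
    have h4 : -|t| ≤ t := neg_abs_le t
    have h5 : r * |t| ≤ r * |t| ^ r := by gcongr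
    have h6 : (2 ^ r + r) * |t| ^ r ≤ r * r * 2 ^ r * |t| ^ r := by gcongr; nlinarith
    have h7 : 0 ≤ r * r * 2 ^ r * t ^ 2 := by positivity
    nlinarith
  · have ht := abs_lt.1 h
    have h0 : 0 < 1 + t := by linarith
    have h1 := abs_rpow_tangent_le (q := r) (by linarith) (1 + t) 1
    rw [abs_of_pos h0] at h1 ⊢
    have e1 : (1 + t) ^ (r - 2) * (1 + t) = (1 + t) ^ (r - 1) := by
      rw [← Real.rpow_add_one h0.ne']; ring_nf
    simp only [abs_one, Real.one_rpow, e1] at h1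
    have key : ((1 + t) ^ (r - 1) - 1) * t ≤ (r - 1) * 2 ^ r * t ^ 2 := by
      rcases le_or_gt 0 t with h' | h'
      · have h3 := abs_rpow_tangent_le (q := r - 1) (by linarith) (1 + t) 1
        have e2 : (1 + t) ^ (r - 1 - 2) * (1 + t) = (1 + t) ^ (r - 2) := by
          rw [← Real.rpow_add_one h0.ne']; ring_nf
        simp only [abs_one, Real.one_rpow, abs_of_pos h0, e2] at h3
        have h4 : (1 + t) ^ (r - 2) ≤ 2 ^ r :=
          (Real.rpow_le_rpow h0.le (by linarith : 1 + t ≤ 2) (by linarith)).trans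
            (Real.rpow_le_rpow_of_exponent_le (by norm_num) (by linarith))
        have h5 : (1 + t) ^ (r - 1) - 1 ≤ (r - 1) * (1 + t) ^ (r - 2) * t := by linarith
        have h6 : 0 ≤ r - 1 := by linarith
        calc _ ≤ (r - 1) * (1 + t) ^ (r - 2) * t * t := by gcongr
          _ ≤ (r - 1) * 2 ^ r * t * t := by gcongr
          _ = _ := by ring
      · have h3 := one_add_mul_self_le_rpow_one_add (s := t) (by linarith) (p := r - 1)
          (by linarith)
        have h6 : 0 ≤ r - 1 := by linarith
        have h7 : (r - 1) * 1 * t ^ 2 ≤ (r - 1) * 2 ^ r * t ^ 2 := by gcongr; linarith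
        nlinarith
    have h8 : r * (((1 + t) ^ (r - 1) - 1) * t) ≤ r * (r * 2 ^ r * t ^ 2) :=
      mul_le_mul_of_nonneg_left (key.trans (by gcongr; linarith)) (by linarith)
    have h9 : 0 ≤ r * r * 2 ^ r * |t| ^ r := by positivity
    nlinarith

/-- Second order Taylor estimate for `|·| ^ r` with `r ≥ 2`. -/
theorem abs_add_rpow_le {r : ℝ} (hr : 2 ≤ r) (a x : ℝ) :
    |a + x| ^ r ≤ |a| ^ r + r * (|a| ^ (r - 2) * a) * x
      + r * r * 2 ^ r * (|a| ^ (r - 2) * x ^ 2 + |x| ^ r) := by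
  rcases eq_or_ne a 0 with rfl | ha
  · have h1 : 0 ≤ |x| ^ r := by positivity
    have hp2 : (1 : ℝ) ≤ 2 ^ r := Real.one_le_rpow (by norm_num) (by linarith)
    have h2 : 1 * |x| ^ r ≤ r * r * 2 ^ r * |x| ^ r := by gcongr; nlinarith
    have h3 : 0 ≤ r * r * 2 ^ r * (|(0 : ℝ)| ^ (r - 2) * x ^ 2) := by positivity
    simp only [zero_add, abs_zero, mul_zero, zero_mul, add_zero] at h3 ⊢
    rw [Real.zero_rpow (by linarith)]
    linarith
  · obtain ⟨t, rfl⟩ : ∃ t, x = a * t := ⟨x / a, by field_simp⟩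
    have h2 := abs_rpow_sub_two_mul_self_mul r a ha
    have h3 : 0 ≤ |a| ^ r := by positivity
    have e : a + a * t = a * (1 + t) := by ring
    rw [e, abs_mul, Real.mul_rpow (abs_nonneg _) (abs_nonneg _), abs_mul a t,
      Real.mul_rpow (abs_nonneg _) (abs_nonneg _)]
    calc |a| ^ r * |1 + t| ^ r
        ≤ |a| ^ r * (1 + r * t + r * r * 2 ^ r * (t ^ 2 + |t| ^ r)) := by
          gcongr; exact abs_one_add_rpow_le hr t
      _ = |a| ^ r + r * (|a| ^ r) * t
          + r * r * 2 ^ r * (|a| ^ r * t ^ 2 + |a| ^ r * |t| ^ r) := by ring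
      _ = |a| ^ r + r * (|a| ^ (r - 2) * a * a) * t
          + r * r * 2 ^ r * (|a| ^ (r - 2) * a * a * t ^ 2 + |a| ^ r * |t| ^ r) := by rw [h2]
      _ = _ := by ring

/-- Pathwise form of Doob's maximal inequality in `L²`. -/
theorem sq_partialSups_le {x : ℕ → ℝ} (N : ℕ) :
    (partialSups x N) ^ 2 ≤
      4 * x N ^ 2 - 4 * ∑ n ∈ Finset.range N, partialSups x n * (x (n + 1) - x n) := by
  have key : (partialSups x N) ^ 2
      + 2 * ∑ n ∈ Finset.range N, partialSups x n * (x (n + 1) - x n)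
      ≤ 2 * partialSups x N * x N := by
    induction N with
    | zero => simp; nlinarith [sq_nonneg (x 0)]
    | succ n ih =>
      rw [Finset.sum_range_succ, partialSups_add_one]
      rcases le_total (x (n + 1)) (partialSups x n) with h | h
      · rw [sup_eq_left.2 h]; nlinarith
      · rw [sup_eq_right.2 h]; nlinarith [sq_nonneg (x (n + 1) - partialSups x n)]
  nlinarith [sq_nonneg (partialSups x N - 2 * x N)]

/-- Summation by parts. -/
theorem abs_sum_mul_sub_le {a K : ℕ → ℝ} {B : ℝ} (ha : Monotone a) (ha0 : 0 ≤ a 0)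
    (hK0 : K 0 = 0) {N : ℕ} (hB : ∀ n ≤ N, |K n| ≤ B) :
    |∑ k ∈ Finset.range N, a k * (K (k + 1) - K k)| ≤ 2 * a N * B := by
  have hB0 : 0 ≤ B := (abs_nonneg _).trans (hB 0 (Nat.zero_le _))
  have key : ∀ n ≤ N, |a n * K n - ∑ k ∈ Finset.range n, a k * (K (k + 1) - K k)|
      ≤ (a n - a 0) * B := by
    intro n
    induction n with
    | zero => simp [hK0]
    | succ n ih =>
      intro hn
      have h1 := ih (by omega)
      rw [Finset.sum_range_succ]
      have h2 : 0 ≤ a (n + 1) - a n := sub_nonneg.2 (ha (Nat.le_succ n))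
      have h3 : |(a (n + 1) - a n) * K (n + 1)| ≤ (a (n + 1) - a n) * B := by
        rw [abs_mul, abs_of_nonneg h2]
        exact mul_le_mul_of_nonneg_left (hB _ hn) h2
      calc _ = |(a n * K n - ∑ k ∈ Finset.range n, a k * (K (k + 1) - K k))
              + (a (n + 1) - a n) * K (n + 1)| := by congr 1; ring
        _ ≤ (a n - a 0) * B + (a (n + 1) - a n) * B := (abs_add_le _ _).trans (add_le_add h1 h3)
        _ = _ := by ring
  have h1 := key N le_rfl
  have haN : 0 ≤ a N := ha0.trans (ha (Nat.zero_le N))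
  have h2 : |a N * K N| ≤ a N * B := by
    rw [abs_mul, abs_of_nonneg haN]
    exact mul_le_mul_of_nonneg_left (hB _ le_rfl) haN
  have h3 : 0 ≤ a 0 * B := mul_nonneg ha0 hB0
  rw [abs_le] at *
  constructor <;> linarith

/-- The discrete Gronwall inequality. -/
theorem le_mul_one_add_pow {m : ℕ → ℝ} {c b : ℝ} (hc : 0 ≤ c) (hb : 0 ≤ b) (h0 : m 0 ≤ 0) {N : ℕ}
    (h : ∀ n < N, m (n + 1) ≤ (1 + c) * m n + b) : ∀ n ≤ N, m n ≤ n * (1 + c) ^ n * b := by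
  intro n
  induction n with
  | zero => intro _; simpa using h0
  | succ n ih =>
    intro hn
    have h1 := ih (by omega)
    have h2 := h n (by omega)
    have h3 : 1 ≤ (1 + c) ^ (n + 1) := one_le_pow₀ (by linarith)
    calc m (n + 1) ≤ (1 + c) * (n * (1 + c) ^ n * b) + 1 * b := by
          rw [one_mul]; exact h2.trans (by gcongr)
      _ ≤ (1 + c) * (n * (1 + c) ^ n * b) + (1 + c) ^ (n + 1) * b := by gcongr
      _ = _ := by push_cast; ring

theorem one_add_pow_le_exp {c T : ℝ} {n : ℕ} (hc : 0 ≤ c) (hn : n * c ≤ T) :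
    (1 + c) ^ n ≤ Real.exp T := by
  calc (1 + c) ^ n ≤ (Real.exp c) ^ n := by
        gcongr; rw [add_comm]; exact Real.add_one_le_exp c
    _ = Real.exp (n * c) := by rw [← Real.exp_nat_mul]
    _ ≤ _ := Real.exp_le_exp.2 hn

/-! ### Moments and maxima of discrete martingales -/

section

variable {Ω : Type*} {mΩ : MeasurableSpace Ω}

theorem integral_mul_eq_zero_of_condExp_eq_zero {Pr : Measure Ω} [IsProbabilityMeasure Pr]
    {m : MeasurableSpace Ω} (hm : m ≤ mΩ) {Z ξ : Ω → ℝ} (hZ : AEStronglyMeasurable[m] Z Pr)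
    (hZξ : Integrable (fun ω => Z ω * ξ ω) Pr) (hξ : Integrable ξ Pr) (h0 : Pr[ξ | m] =ᵐ[Pr] 0) :
    ∫ ω, Z ω * ξ ω ∂Pr = 0 := by
  have h1 := condExp_mul_of_aestronglyMeasurable_left hZ hZξ hξ
  have h2 : ∫ ω, Pr[Z * ξ | m] ω ∂Pr = ∫ ω, Z ω * ξ ω ∂Pr := integral_condExp hm
  rw [← h2]
  refine integral_eq_zero_of_ae ?_
  filter_upwards [h1, h0] with ω h1 h0
  simp [h1, h0]

theorem aestronglyMeasurable_comp {Pr : Measure Ω} {m : MeasurableSpace Ω} {f : Ω → ℝ} {g : ℝ → ℝ}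
    (hg : Measurable g) (hf : AEStronglyMeasurable[m] f Pr) :
    AEStronglyMeasurable[m] (fun ω => g (f ω)) Pr := by
  obtain ⟨f', hf', hff'⟩ := hf
  refine ⟨fun ω => g (f' ω), (hg.comp hf'.measurable).stronglyMeasurable, ?_⟩
  filter_upwards [hff'] with ω h
  rw [h]

theorem integrable_abs_rpow_of_memLp {Pr : Measure Ω} {f : Ω → ℝ} {r : ℝ} (hr : 0 < r)
    (hf : MemLp f (ENNReal.ofReal r) Pr) : Integrable (fun ω => |f ω| ^ r) Pr := by
  have := hf.integrable_norm_rpow (by simpa using hr) (by simp)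
  simpa [ENNReal.toReal_ofReal hr.le] using this

/-- A sequence of increments `ξ k` in `Lʳ` that are martingale differences with respect to `𝓖`:
`ξ k` is `𝓖 (k + 1)`-measurable up to a null set and `𝔼[ξ k | 𝓖 k] = 0`. -/
structure IsMartingaleDiff (𝓖 : Filtration ℕ mΩ) (Pr : Measure Ω) (r : ℝ) (ξ : ℕ → Ω → ℝ) :
    Prop where
  meas : ∀ k, AEStronglyMeasurable[𝓖 (k + 1)] (ξ k) Pr
  memLp : ∀ k, MemLp (ξ k) (ENNReal.ofReal r) Pr
  condExp_eq_zero : ∀ k, Pr[ξ k | 𝓖 k] =ᵐ[Pr] 0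

variable {𝓖 : Filtration ℕ mΩ} {Pr : Measure Ω} {r : ℝ} {ξ : ℕ → Ω → ℝ}

namespace IsMartingaleDiff

theorem sum_meas (h : IsMartingaleDiff 𝓖 Pr r ξ) (n : ℕ) :
    AEStronglyMeasurable[𝓖 n] (fun ω => ∑ k ∈ Finset.range n, ξ k ω) Pr := by
  have hk : ∀ k ∈ Finset.range n, AEStronglyMeasurable[𝓖 n] (ξ k) Pr := fun k hk =>
    (h.meas k).mono (𝓖.mono (Finset.mem_range.1 hk))
  refine ⟨fun ω => ∑ k ∈ (Finset.range n).attach, (hk k k.2).mk (ξ k) ω,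
    Finset.stronglyMeasurable_fun_sum _ fun k _ => (hk k k.2).stronglyMeasurable_mk, ?_⟩
  have h1 : ∀ᵐ ω ∂Pr, ∀ k : Finset.range n, ξ k ω = (hk k k.2).mk (ξ k) ω :=
    ae_all_iff.2 fun k => (hk k k.2).ae_eq_mk
  filter_upwards [h1] with ω h1
  rw [← Finset.sum_attach]
  exact Finset.sum_congr rfl fun k _ => h1 k

theorem sum_memLp (h : IsMartingaleDiff 𝓖 Pr r ξ) (n : ℕ) :
    MemLp (fun ω => ∑ k ∈ Finset.range n, ξ k ω) (ENNReal.ofReal r) Pr :=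
  memLp_finsetSum _ fun k _ => h.memLp k

theorem integrable [IsProbabilityMeasure Pr] (hr : 1 ≤ r) (h : IsMartingaleDiff 𝓖 Pr r ξ) (k : ℕ) :
    Integrable (ξ k) Pr :=
  (h.memLp k).integrable (by simpa using hr)

end IsMartingaleDiff

/-- Growth of the moment of order `r ≥ 2` of a martingale in one step. -/
theorem integral_abs_sum_rpow_succ_le [IsProbabilityMeasure Pr] (hr : 2 ≤ r)
    (hξ : IsMartingaleDiff 𝓖 Pr r ξ) {S h : ℝ} (hh : 0 < h) (hh1 : h ≤ 1)
    (hS : ∀ k, ∫ ω, |ξ k ω| ^ r ∂Pr ≤ S) (n : ℕ) :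
    ∫ ω, |∑ k ∈ Finset.range (n + 1), ξ k ω| ^ r ∂Pr
      ≤ (1 + r * r * 2 ^ r * h) * ∫ ω, |∑ k ∈ Finset.range n, ξ k ω| ^ r ∂Pr
        + 2 * (r * r * 2 ^ r) * h ^ (1 - r / 2) * S := by
  set K : Ω → ℝ := fun ω => ∑ k ∈ Finset.range n, ξ k ω with hK
  have hr0 : 0 < r := by linarith
  have hKi := integrable_abs_rpow_of_memLp hr0 (hξ.sum_memLp n)
  have hxi := integrable_abs_rpow_of_memLp hr0 (hξ.memLp n)
  have hKi' := integrable_abs_rpow_of_memLp hr0 (hξ.sum_memLp (n + 1))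
  have hKm := hξ.sum_meas n
  have hZm : AEStronglyMeasurable[𝓖 n] (fun ω => r * (|K ω| ^ (r - 2) * K ω)) Pr :=
    aestronglyMeasurable_comp (g := fun x => r * (|x| ^ (r - 2) * x)) (by fun_prop) hKm
  have hb : ∀ u v : ℝ, |u| ^ (r - 2) * v ^ 2 ≤ |u| ^ r + |v| ^ r := by
    intro u v
    have := rpow_mul_rpow_le_add (abs_nonneg u) (abs_nonneg v) (by linarith : 0 ≤ r - 2)
      (by norm_num : (0 : ℝ) ≤ 2)
    simpa using this
  have hZi : Integrable (fun ω => r * (|K ω| ^ (r - 2) * K ω) * ξ n ω) Pr := by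
    refine (((hKi.add hKi).add (hKi.add hxi)).const_mul r).mono'
      ((hZm.mono (𝓖.le n)).mul (hξ.integrable (by linarith) n).aestronglyMeasurable)
      (.of_forall fun ω => ?_)
    have h1 := hb (K ω) (K ω)
    have h2 := hb (K ω) (ξ n ω)
    have h3 : |K ω| * |ξ n ω| ≤ K ω ^ 2 + ξ n ω ^ 2 := by
      rw [← sq_abs (K ω), ← sq_abs (ξ n ω)]
      nlinarith [sq_nonneg (|K ω| - |ξ n ω|), sq_nonneg (|K ω|), sq_nonneg (|ξ n ω|)]
    have h4 : 0 ≤ |K ω| ^ (r - 2) := by positivity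
    rw [Real.norm_eq_abs, abs_mul, abs_mul, abs_mul, abs_of_pos hr0, abs_of_nonneg h4, mul_assoc]
    refine mul_le_mul_of_nonneg_left ?_ hr0.le
    calc _ = |K ω| ^ (r - 2) * (|K ω| * |ξ n ω|) := by ring
      _ ≤ |K ω| ^ (r - 2) * (K ω ^ 2 + ξ n ω ^ 2) := by gcongr
      _ = |K ω| ^ (r - 2) * K ω ^ 2 + |K ω| ^ (r - 2) * ξ n ω ^ 2 := by ring
      _ ≤ _ := add_le_add h1 h2
  have h0 := integral_mul_eq_zero_of_condExp_eq_zero (𝓖.le n) hZm hZi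
    (hξ.integrable (by linarith) n) (hξ.condExp_eq_zero n)
  set C := r * r * 2 ^ r with hC
  have hC0 : 0 ≤ C := by positivity
  have hp1 : 1 ≤ h ^ (1 - r / 2) := Real.one_le_rpow_of_pos_of_le_one_of_nonpos hh hh1 (by linarith)
  have hpt : ∀ ω, |∑ k ∈ Finset.range (n + 1), ξ k ω| ^ r
      ≤ ((1 + C * h) * |K ω| ^ r + r * (|K ω| ^ (r - 2) * K ω) * ξ n ω)
        + 2 * C * h ^ (1 - r / 2) * |ξ n ω| ^ r := by
    intro ω
    rw [Finset.sum_range_succ]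
    have h1 := abs_add_rpow_le hr (K ω) (ξ n ω)
    -- Young's inequality is applied to `ξ / √h`, so that the factor `h` falls on `|K| ^ r`.
    have h2 : |K ω| ^ (r - 2) * ξ n ω ^ 2 ≤ h * |K ω| ^ r + h ^ (1 - r / 2) * |ξ n ω| ^ r := by
      have h3 := hb (K ω) (ξ n ω / √h)
      have h4 : |ξ n ω / √h| ^ r = h ^ (-(r / 2)) * |ξ n ω| ^ r := by
        rw [abs_div, Real.div_rpow (abs_nonneg _) (abs_nonneg _), abs_of_nonneg (Real.sqrt_nonneg h),
          Real.sqrt_eq_rpow, ← Real.rpow_mul hh.le, Real.rpow_neg hh.le, div_eq_inv_mul]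
        ring_nf
      rw [div_pow, Real.sq_sqrt hh.le, h4] at h3
      have h5 : h ^ (1 - r / 2) = h * h ^ (-(r / 2)) := by
        rw [sub_eq_add_neg, Real.rpow_add hh, Real.rpow_one]
      rw [h5]
      calc _ = h * (|K ω| ^ (r - 2) * (ξ n ω ^ 2 / h)) := by field_simp
        _ ≤ h * (|K ω| ^ r + h ^ (-(r / 2)) * |ξ n ω| ^ r) := by gcongr
        _ = _ := by ring
    have h6 : 1 * |ξ n ω| ^ r ≤ h ^ (1 - r / 2) * |ξ n ω| ^ r := by gcongr
    have h7 : C * (|K ω| ^ (r - 2) * ξ n ω ^ 2 + |ξ n ω| ^ r)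
        ≤ C * (h * |K ω| ^ r + 2 * (h ^ (1 - r / 2) * |ξ n ω| ^ r)) :=
      mul_le_mul_of_nonneg_left (by linarith) hC0
    calc _ ≤ _ := h1
      _ ≤ |K ω| ^ r + r * (|K ω| ^ (r - 2) * K ω) * ξ n ω
          + C * (h * |K ω| ^ r + 2 * (h ^ (1 - r / 2) * |ξ n ω| ^ r)) := by gcongr
      _ = _ := by ring
  have hi1 : Integrable (fun ω => (1 + C * h) * |K ω| ^ r) Pr := hKi.const_mul _
  have hi2 : Integrable (fun ω => 2 * C * h ^ (1 - r / 2) * |ξ n ω| ^ r) Pr := hxi.const_mul _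
  refine (integral_mono hKi' ((hi1.add hZi).add hi2) hpt).trans ?_
  have e : ∫ ω, (((1 + C * h) * |K ω| ^ r + r * (|K ω| ^ (r - 2) * K ω) * ξ n ω)
        + 2 * C * h ^ (1 - r / 2) * |ξ n ω| ^ r) ∂Pr
      = (1 + C * h) * ∫ ω, |K ω| ^ r ∂Pr
        + 2 * C * h ^ (1 - r / 2) * ∫ ω, |ξ n ω| ^ r ∂Pr := by
    have hi12 : Integrable
        (fun ω => (1 + C * h) * |K ω| ^ r + r * (|K ω| ^ (r - 2) * K ω) * ξ n ω) Pr := hi1.add hZi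
    rw [integral_add hi12 hi2, integral_add hi1 hZi, h0, integral_const_mul, integral_const_mul,
      add_zero]
  refine e.le.trans ?_
  have := hS n
  gcongr

/-- Moment bound for a martingale after `n` steps with `n h ≤ T`. The order `h ^ (-r / 2)` is that
of `n ^ (r / 2)`, as for independent centred increments. -/
theorem integral_abs_sum_rpow_le [IsProbabilityMeasure Pr] (hr : 2 ≤ r)
    (hξ : IsMartingaleDiff 𝓖 Pr r ξ) {S h T : ℝ} (hh : 0 < h) (hh1 : h ≤ 1)
    (hS : ∀ k, ∫ ω, |ξ k ω| ^ r ∂Pr ≤ S) {n : ℕ} (hn : n * h ≤ T) :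
    ∫ ω, |∑ k ∈ Finset.range n, ξ k ω| ^ r ∂Pr
      ≤ T * Real.exp (r * r * 2 ^ r * T) * (2 * (r * r * 2 ^ r)) * h ^ (-(r / 2)) * S := by
  have hS0 : 0 ≤ S := (integral_nonneg fun ω => by positivity).trans (hS 0)
  have hC0 : 0 ≤ r * r * 2 ^ r := by positivity
  have h1 := le_mul_one_add_pow (m := fun n => ∫ ω, |∑ k ∈ Finset.range n, ξ k ω| ^ r ∂Pr)
    (c := r * r * 2 ^ r * h) (b := 2 * (r * r * 2 ^ r) * h ^ (1 - r / 2) * S) (N := n)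
    (by positivity) (by positivity)
    (by simp [Real.zero_rpow (by linarith : r ≠ 0)])
    (fun k _ => integral_abs_sum_rpow_succ_le hr hξ hh hh1 hS k) n le_rfl
  refine h1.trans ?_
  have h2 : (1 + r * r * 2 ^ r * h) ^ n ≤ Real.exp (r * r * 2 ^ r * T) :=
    one_add_pow_le_exp (by positivity) (by
      calc n * (r * r * 2 ^ r * h) = r * r * 2 ^ r * (n * h) := by ring
        _ ≤ _ := by gcongr)
  have h3 : h ^ (1 - r / 2) = h * h ^ (-(r / 2)) := by
    rw [sub_eq_add_neg, Real.rpow_add hh, Real.rpow_one]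
  have hT : 0 ≤ T := (by positivity : 0 ≤ n * h).trans hn
  rw [h3]
  calc _ = (n * h) * (1 + r * r * 2 ^ r * h) ^ n * (2 * (r * r * 2 ^ r)) * h ^ (-(r / 2)) * S := by
        ring
    _ ≤ _ := by gcongr

theorem aestronglyMeasurable_partialSups {m : MeasurableSpace Ω} {x : ℕ → Ω → ℝ} {n : ℕ}
    (hx : ∀ k ≤ n, AEStronglyMeasurable[m] (x k) Pr) :
    AEStronglyMeasurable[m] (fun ω => partialSups (fun k => x k ω) n) Pr := by
  induction n with
  | zero => simpa using hx 0 le_rfl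
  | succ n ih =>
    simp only [partialSups_add_one]
    have h1 := ih fun k hk => hx k (by omega)
    have h2 := hx _ le_rfl
    exact ⟨h1.mk _ ⊔ h2.mk _, h1.stronglyMeasurable_mk.sup h2.stronglyMeasurable_mk,
      h1.ae_eq_mk.sup h2.ae_eq_mk⟩

theorem partialSups_nonneg {x : ℕ → ℝ} (hx : ∀ n, 0 ≤ x n) (n : ℕ) : 0 ≤ partialSups x n :=
  (hx 0).trans (le_partialSups_of_le x (Nat.zero_le n))

theorem sq_partialSups_le_sum (x : ℕ → ℝ) (n : ℕ) :
    (partialSups x n) ^ 2 ≤ ∑ k ∈ Finset.range (n + 1), x k ^ 2 := by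
  induction n with
  | zero => simp
  | succ n ih =>
    rw [Finset.sum_range_succ, partialSups_add_one]
    rcases le_total (x (n + 1)) (partialSups x n) with h | h
    · rw [sup_eq_left.2 h]; nlinarith [sq_nonneg (x (n + 1))]
    · rw [sup_eq_right.2 h]
      have : 0 ≤ ∑ k ∈ Finset.range (n + 1), x k ^ 2 := Finset.sum_nonneg fun k _ => sq_nonneg _
      linarith

/-- Doob's maximal inequality for the submartingale `|∑ ξ| ^ p`, which lies in `L²`. -/
theorem integral_sq_partialSups_le [IsProbabilityMeasure Pr] {p : ℝ} (hp : 1 ≤ p)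
    (hξ : IsMartingaleDiff 𝓖 Pr (2 * p) ξ) (N : ℕ) :
    Integrable (fun ω => (partialSups (fun n => |∑ k ∈ Finset.range n, ξ k ω| ^ p) N) ^ 2) Pr ∧
    ∫ ω, (partialSups (fun n => |∑ k ∈ Finset.range n, ξ k ω| ^ p) N) ^ 2 ∂Pr
      ≤ 4 * ∫ ω, |∑ k ∈ Finset.range N, ξ k ω| ^ (2 * p) ∂Pr := by
  set K : ℕ → Ω → ℝ := fun n ω => ∑ k ∈ Finset.range n, ξ k ω with hK
  set s : ℕ → Ω → ℝ := fun n ω => partialSups (fun n => |K n ω| ^ p) n with hs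
  have hsq : ∀ u : ℝ, (|u| ^ p) ^ 2 = |u| ^ (2 * p) := fun u => by
    rw [← Real.rpow_natCast, ← Real.rpow_mul (abs_nonneg u), mul_comm]; norm_num
  have hKi : ∀ n, Integrable (fun ω => |K n ω| ^ (2 * p)) Pr := fun n =>
    integrable_abs_rpow_of_memLp (by linarith) (hξ.sum_memLp n)
  have hxi : ∀ n, Integrable (fun ω => |ξ n ω| ^ (2 * p)) Pr := fun n =>
    integrable_abs_rpow_of_memLp (by linarith) (hξ.memLp n)
  have hsm : ∀ n, AEStronglyMeasurable[𝓖 n] (s n) Pr := fun n =>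
    aestronglyMeasurable_partialSups fun k hk =>
      aestronglyMeasurable_comp (f := K k) (g := fun x => |x| ^ p) (by fun_prop)
        ((hξ.sum_meas k).mono (𝓖.mono hk))
  have hsi : ∀ n, Integrable (fun ω => s n ω ^ 2) Pr := fun n => by
    refine (integrable_finsetSum (Finset.range (n + 1)) fun k _ => hKi k).mono'
      (((hsm n).mono (𝓖.le n)).pow 2) (.of_forall fun ω => ?_)
    rw [Real.norm_eq_abs, abs_of_nonneg (sq_nonneg _)]
    refine (sq_partialSups_le_sum _ n).trans (le_of_eq ?_)
    exact Finset.sum_congr rfl fun k _ => hsq _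
  have hZm : ∀ n, AEStronglyMeasurable[𝓖 n]
      (fun ω => s n ω * (p * (|K n ω| ^ (p - 2) * K n ω))) Pr := fun n =>
    (hsm n).mul (aestronglyMeasurable_comp (g := fun x => p * (|x| ^ (p - 2) * x)) (by fun_prop)
      (hξ.sum_meas n))
  have hr : 1 ≤ 2 * p := by linarith
  have hZi : ∀ n, Integrable
      (fun ω => s n ω * (p * (|K n ω| ^ (p - 2) * K n ω)) * ξ n ω) Pr := fun n => by
    refine (((hsi n).add ((hKi n).add (hxi n))).const_mul p).mono'
      (((hZm n).mono (𝓖.le n)).mul (hξ.integrable hr n).aestronglyMeasurable)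
      (.of_forall fun ω => ?_)
    have h1 : 0 ≤ s n ω := partialSups_nonneg (fun k => by positivity) n
    have h2 : |K n ω| ^ (p - 2) * |K n ω| ≤ |K n ω| ^ (p - 1) := by
      rcases eq_or_ne (K n ω) 0 with h | h
      · rw [h]; simp; positivity
      · rw [← Real.rpow_add_one (abs_pos.2 h).ne']; ring_nf; rfl
    have h3 := rpow_mul_rpow_le_add (abs_nonneg (K n ω)) (abs_nonneg (ξ n ω))
      (by linarith : 0 ≤ 2 * (p - 1)) (by norm_num : (0 : ℝ) ≤ 2)
    have h4 : |K n ω| ^ (2 * (p - 1)) = (|K n ω| ^ (p - 1)) ^ 2 := by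
      rw [← Real.rpow_natCast, ← Real.rpow_mul (abs_nonneg _), mul_comm]; norm_num
    rw [h4, show 2 * (p - 1) + 2 = 2 * p by ring, Real.rpow_two] at h3
    have h5 : 0 ≤ |K n ω| ^ (p - 2) := by positivity
    have h6 : 0 ≤ |K n ω| ^ (p - 1) := by positivity
    have h7 : 0 ≤ |ξ n ω| := abs_nonneg _
    rw [Real.norm_eq_abs, abs_mul, abs_mul, abs_mul, abs_mul, abs_of_nonneg h1, abs_of_nonneg h5,
      abs_of_nonneg (by linarith : 0 ≤ p)]
    calc _ = p * (s n ω * ((|K n ω| ^ (p - 2) * |K n ω|) * |ξ n ω|)) := by ring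
      _ ≤ p * (s n ω * (|K n ω| ^ (p - 1) * |ξ n ω|)) := by gcongr
      _ ≤ p * (s n ω ^ 2 + (|K n ω| ^ (p - 1) * |ξ n ω|) ^ 2) := by
        gcongr
        nlinarith [sq_nonneg (s n ω - |K n ω| ^ (p - 1) * |ξ n ω|), sq_nonneg (s n ω),
          sq_nonneg (|K n ω| ^ (p - 1) * |ξ n ω|)]
      _ ≤ _ := by
        rw [mul_pow]
        exact mul_le_mul_of_nonneg_left (add_le_add le_rfl h3) (by linarith)
  have h0 : ∀ n, ∫ ω, s n ω * (p * (|K n ω| ^ (p - 2) * K n ω)) * ξ n ω ∂Pr = 0 := fun n =>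
    integral_mul_eq_zero_of_condExp_eq_zero (𝓖.le n) (hZm n) (hZi n) (hξ.integrable hr n)
      (hξ.condExp_eq_zero n)
  refine ⟨hsi N, ?_⟩
  have hpt : ∀ ω, s N ω ^ 2 ≤ 4 * |K N ω| ^ (2 * p)
      - 4 * ∑ n ∈ Finset.range N, s n ω * (p * (|K n ω| ^ (p - 2) * K n ω)) * ξ n ω := by
    intro ω
    refine (sq_partialSups_le N).trans ?_
    rw [hsq]
    refine sub_le_sub_left (mul_le_mul_of_nonneg_left (Finset.sum_le_sum fun n _ => ?_)
      (by norm_num)) _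
    rw [mul_assoc]
    refine mul_le_mul_of_nonneg_left ?_ (partialSups_nonneg (fun k => by positivity) n)
    have h1 := abs_rpow_tangent_le hp (K n ω) (K (n + 1) ω)
    have h2 : K (n + 1) ω - K n ω = ξ n ω := by simp [hK, Finset.sum_range_succ]
    rw [h2] at h1
    linarith
  have hi : Integrable (fun ω => ∑ n ∈ Finset.range N,
      s n ω * (p * (|K n ω| ^ (p - 2) * K n ω)) * ξ n ω) Pr :=
    integrable_finsetSum _ fun n _ => hZi n
  refine (integral_mono (hsi N) (((hKi N).const_mul 4).sub (hi.const_mul 4)) hpt).trans ?_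
  rw [integral_sub' ((hKi N).const_mul 4) (hi.const_mul 4), integral_const_mul, integral_const_mul,
    integral_finsetSum _ fun n _ => hZi n, Finset.sum_eq_zero fun n _ => h0 n, mul_zero, sub_zero]

end

/-! ### The pathwise error bound -/

/-- Pathwise error bound. The martingale part enters only through a bound `B` for the partial sums
of `b k * r₂ k`, where `b k` is the weight `(1 + c) ^ (-(k + 1)) * A k / maxⱼ≤ₖ |e j|`. -/
theorem sq_partialSups_abs_le {e A b r₁ r₂ : ℕ → ℝ} {h κ T B : ℝ} {N : ℕ} (hh : 0 < h) (hh1 : h ≤ 1)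
    (hκ : 0 ≤ κ) (hN : N * h ≤ T) (he0 : e 0 = 0)
    (he : ∀ n < N, e (n + 1) ^ 2 ≤ (A n + (r₁ n + r₂ n)) ^ 2)
    (hA : ∀ n < N, A n ^ 2 ≤ (1 + κ * h) * e n ^ 2)
    (hb : ∀ n < N, partialSups (fun k => |e k|) n * b n
      = ((1 + (2 * κ + 1) * h) ^ (n + 1))⁻¹ * A n)
    (hB : ∀ n ≤ N, |∑ k ∈ Finset.range n, b k * r₂ k| ≤ B) :
    (partialSups (fun k => |e k|) N) ^ 2 ≤
      16 * Real.exp ((2 * κ + 1) * T) ^ 2 * B ^ 2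
      + 6 * Real.exp ((2 * κ + 1) * T) * (h⁻¹ * ∑ k ∈ Finset.range N, r₁ k ^ 2
        + ∑ k ∈ Finset.range N, r₂ k ^ 2) := by
  set a : ℕ → ℝ := fun n => partialSups (fun k => |e k|) n with ha
  set K : ℕ → ℝ := fun n => ∑ k ∈ Finset.range n, b k * r₂ k with hK
  set ρ := 1 + (2 * κ + 1) * h with hρ
  set E := Real.exp ((2 * κ + 1) * T) with hE
  have hρ1 : 1 ≤ ρ := by rw [hρ]; nlinarith
  have hρ0 : 0 < ρ := by linarith
  have haM : Monotone a := (partialSups fun k => |e k|).monotone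
  have ha0 : ∀ n, 0 ≤ a n := partialSups_nonneg fun k => abs_nonneg _
  have hB0 : 0 ≤ B := (abs_nonneg _).trans (hB 0 (Nat.zero_le _))
  set I : ℕ → ℝ := fun n => ∑ k ∈ Finset.range n, 3 * (h⁻¹ * r₁ k ^ 2 + r₂ k ^ 2) with hI
  have hI0 : ∀ n, 0 ≤ 3 * (h⁻¹ * r₁ n ^ 2 + r₂ n ^ 2) := fun n => by positivity
  have hIM : ∀ n ≤ N, I n ≤ I N := fun n hn =>
    Finset.sum_le_sum_of_subset_of_nonneg (Finset.range_mono hn) fun k _ _ => hI0 k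
  -- Unrolling the recursion with the integrating factor `ρ ^ (-n)`.
  have step : ∀ n ≤ N, (ρ ^ n)⁻¹ * e n ^ 2
      ≤ 2 * ∑ k ∈ Finset.range n, a k * (K (k + 1) - K k) + I n := by
    intro n
    induction n with
    | zero => intro _; simp [he0, hI]
    | succ n ih =>
      intro hn
      have h1 := ih (by omega)
      have h2 := he n (by omega)
      have h3 := hA n (by omega)
      have h4 := hb n (by omega)
      have h5 : a n * (K (n + 1) - K n) = (ρ ^ (n + 1))⁻¹ * (A n * r₂ n) := by
        have : K (n + 1) - K n = b n * r₂ n := by simp [hK, Finset.sum_range_succ]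
        rw [this, ← mul_assoc, h4, mul_assoc]
      have h6 : 2 * A n * r₁ n ≤ h * A n ^ 2 + h⁻¹ * r₁ n ^ 2 := by
        have h7 : 0 ≤ h⁻¹ * (h * A n - r₁ n) ^ 2 := by positivity
        have h8 : h⁻¹ * (h * A n - r₁ n) ^ 2
            = h * A n ^ 2 + h⁻¹ * r₁ n ^ 2 - 2 * A n * r₁ n := by field_simp; ring
        linarith
      have h9 : 1 ≤ h⁻¹ := (one_le_inv₀ hh).2 hh1
      have h10 : (1 + h) * A n ^ 2 ≤ ρ * e n ^ 2 := by
        calc _ ≤ (1 + h) * ((1 + κ * h) * e n ^ 2) := by gcongr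
          _ = (1 + (κ + 1) * h + κ * (h * h)) * e n ^ 2 := by ring
          _ ≤ (1 + (κ + 1) * h + κ * (h * 1)) * e n ^ 2 := by gcongr
          _ = _ := by rw [hρ]; ring
      have h11 : e (n + 1) ^ 2 ≤ ρ * e n ^ 2 + 2 * (A n * r₂ n)
          + 3 * (h⁻¹ * r₁ n ^ 2 + r₂ n ^ 2) := by
        nlinarith [sq_nonneg (r₁ n - r₂ n), mul_nonneg (sub_nonneg.2 h9) (sq_nonneg (r₁ n)),
          sq_nonneg (r₂ n)]
      have h12 : (ρ ^ (n + 1))⁻¹ ≤ 1 := inv_le_one_of_one_le₀ (one_le_pow₀ hρ1)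
      rw [Finset.sum_range_succ, h5]
      calc (ρ ^ (n + 1))⁻¹ * e (n + 1) ^ 2
          ≤ (ρ ^ (n + 1))⁻¹ * (ρ * e n ^ 2 + 2 * (A n * r₂ n)
            + 3 * (h⁻¹ * r₁ n ^ 2 + r₂ n ^ 2)) := by gcongr
        _ = (ρ ^ n)⁻¹ * e n ^ 2 + 2 * ((ρ ^ (n + 1))⁻¹ * (A n * r₂ n))
            + (ρ ^ (n + 1))⁻¹ * (3 * (h⁻¹ * r₁ n ^ 2 + r₂ n ^ 2)) := by
          rw [pow_succ]; field_simp
        _ ≤ (ρ ^ n)⁻¹ * e n ^ 2 + 2 * ((ρ ^ (n + 1))⁻¹ * (A n * r₂ n))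
            + 1 * (3 * (h⁻¹ * r₁ n ^ 2 + r₂ n ^ 2)) := by
          gcongr
        _ ≤ _ := by
          simp only [hI, Finset.sum_range_succ] at h1 ⊢
          linarith
  have hE1 : ∀ n ≤ N, ρ ^ n ≤ E := fun n hn => by
    refine (pow_le_pow_right₀ hρ1 hn).trans (one_add_pow_le_exp (by positivity) ?_)
    calc N * ((2 * κ + 1) * h) = (2 * κ + 1) * (N * h) := by ring
      _ ≤ _ := by gcongr
  have hE0 : 0 < E := Real.exp_pos _
  have bound : ∀ n ≤ N, e n ^ 2 ≤ E * (4 * a N * B + I N) := by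
    intro n hn
    have h1 := (le_abs_self _).trans (abs_sum_mul_sub_le haM (ha0 0) (by simp [hK])
      (fun k hk => hB k (hk.trans hn)) (N := n) (K := K))
    have h2 := step n hn
    have h3 := hE1 n hn
    have h4 : a n * B ≤ a N * B := by gcongr; exact haM hn
    have h5 : (ρ ^ n)⁻¹ * e n ^ 2 ≤ 4 * a N * B + I N := by
      have := hIM n hn
      linarith
    have h6 : 0 ≤ 4 * a N * B + I N := le_trans (by positivity) h5
    calc e n ^ 2 = ρ ^ n * ((ρ ^ n)⁻¹ * e n ^ 2) := by field_simp
      _ ≤ ρ ^ n * (4 * a N * B + I N) := by gcongr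
      _ ≤ _ := by gcongr
  have final : a N ^ 2 ≤ E * (4 * a N * B + I N) := by
    obtain ⟨n, hn, hn'⟩ : ∃ n ≤ N, a N = |e n| := by
      obtain ⟨n, hn, h⟩ := exists_partialSups_eq (fun k => |e k|) N
      exact ⟨n, hn, h⟩
    calc a N ^ 2 = e n ^ 2 := by rw [hn', sq_abs]
      _ ≤ _ := bound n hn
  have hIN : I N = 3 * (h⁻¹ * ∑ k ∈ Finset.range N, r₁ k ^ 2 + ∑ k ∈ Finset.range N, r₂ k ^ 2) := by
    simp only [hI, ← Finset.mul_sum, Finset.sum_add_distrib]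
  change a N ^ 2 ≤ _
  -- `4 E a B ≤ a ^ 2 / 2 + 8 E ^ 2 B ^ 2` absorbs the maximum of the error on the left.
  nlinarith [sq_nonneg (a N - 4 * E * B)]

/-- Monotonicity of the implicit part `x ↦ x - c x⁻¹`. -/
theorem sq_sub_le_of_implicit {x y d k : ℝ} (hx : 0 < x) (hy : 0 < y) (hk : 0 ≤ k)
    (h : x - y = d + k * (x⁻¹ - y⁻¹)) : (x - y) ^ 2 ≤ d ^ 2 := by
  have h1 : (x⁻¹ - y⁻¹) * (x - y) = -((x - y) ^ 2 * (x⁻¹ * y⁻¹)) := by field_simp; ring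
  have h2 : 0 ≤ k * ((x - y) ^ 2 * (x⁻¹ * y⁻¹)) := by positivity
  have h3 : d = (x - y) - k * (x⁻¹ - y⁻¹) := by linarith
  rw [h3]
  nlinarith [sq_nonneg (k * (x⁻¹ - y⁻¹))]

/-- The explicit part of one step of the scheme is Lipschitz up to a factor `1 + O(h)`. -/
theorem sq_explicit_le {Δ δ e h L C : ℝ} (hh : 0 < h) (hL : 0 ≤ L)
    (h1 : |Δ| ≤ |e|) (h2 : δ * Δ ≤ L * |Δ| ^ 2) (h3 : |δ| ≤ C * h ^ (-(1 / 2) : ℝ) * |e|) :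
    (Δ + h * δ) ^ 2 ≤ (1 + (2 * L + C ^ 2) * h) * e ^ 2 := by
  have h4 : Δ ^ 2 ≤ e ^ 2 := sq_le_sq.2 h1
  have h5 : δ ^ 2 ≤ C ^ 2 * h⁻¹ * e ^ 2 := by
    have : (h ^ (-(1 / 2) : ℝ)) ^ 2 = h⁻¹ := by
      rw [← Real.rpow_natCast, ← Real.rpow_mul hh.le, ← Real.rpow_neg_one]; norm_num
    calc δ ^ 2 = |δ| ^ 2 := (sq_abs _).symm
      _ ≤ (C * h ^ (-(1 / 2) : ℝ) * |e|) ^ 2 := by gcongr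
      _ = _ := by rw [mul_pow, mul_pow, this, sq_abs]
  have h6 : h ^ 2 * δ ^ 2 ≤ C ^ 2 * h * e ^ 2 := by
    calc h ^ 2 * δ ^ 2 ≤ h ^ 2 * (C ^ 2 * h⁻¹ * e ^ 2) := by gcongr
      _ = _ := by field_simp
  rw [sq_abs] at h2
  have h7 : 2 * h * (δ * Δ) ≤ 2 * h * (L * e ^ 2) :=
    mul_le_mul_of_nonneg_left (h2.trans (by gcongr)) (by positivity)
  nlinarith

/-! ### Error bound in `L²ᵖ` -/

section

variable {Ω : Type*} {mΩ : MeasurableSpace Ω}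

/-- Multiplying martingale differences by bounded weights that are known one step ahead gives
martingale differences. -/
theorem IsMartingaleDiff.bounded_mul {𝓖 : Filtration ℕ mΩ} {Pr : Measure Ω}
    [IsProbabilityMeasure Pr] {r D : ℝ} {ξ b : ℕ → Ω → ℝ} (hr : 1 ≤ r)
    (h : IsMartingaleDiff 𝓖 Pr r ξ) (hb : ∀ k, AEStronglyMeasurable[𝓖 k] (b k) Pr)
    (hbD : ∀ k, ∀ᵐ ω ∂Pr, |b k ω| ≤ D) :
    IsMartingaleDiff 𝓖 Pr r (fun k ω => b k ω * ξ k ω) := by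
  have hL : ∀ k, MemLp (fun ω => b k ω * ξ k ω) (ENNReal.ofReal r) Pr := fun k => by
    refine (h.memLp k).of_le_mul (c := D)
      (((hb k).mono (𝓖.le k)).mul (h.memLp k).aestronglyMeasurable) ?_
    filter_upwards [hbD k] with ω hω
    rw [norm_mul]
    exact mul_le_mul_of_nonneg_right hω (norm_nonneg _)
  refine ⟨fun k => ((hb k).mono (𝓖.mono (Nat.le_succ k))).mul (h.meas k), hL, fun k => ?_⟩
  have h1 := condExp_mul_of_aestronglyMeasurable_left (hb k)
    ((hL k).integrable (by simpa using hr)) (h.integrable hr k)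
  filter_upwards [h1, h.condExp_eq_zero k] with ω h1 h2
  exact h1.trans (by simp [h2])

theorem add_add_rpow_le {x y z p : ℝ} (hp : 1 ≤ p) (hx : 0 ≤ x) (hy : 0 ≤ y) (hz : 0 ≤ z) :
    (x + y + z) ^ p ≤ 3 ^ (p - 1) * (x ^ p + y ^ p + z ^ p) := by
  have := Real.rpow_sum_le_const_mul_sum_rpow_of_nonneg (s := Finset.univ) (f := ![x, y, z]) hp
    (by intro i _; fin_cases i <;> simpa)
  simpa [Fin.sum_univ_three] using this

theorem sum_sq_rpow_le {p : ℝ} (hp : 1 ≤ p) (u : ℕ → ℝ) (N : ℕ) :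
    (∑ k ∈ Finset.range N, u k ^ 2) ^ p
      ≤ (N : ℝ) ^ (p - 1) * ∑ k ∈ Finset.range N, |u k| ^ (2 * p) := by
  have := Real.rpow_sum_le_const_mul_sum_rpow_of_nonneg (s := Finset.range N)
    (f := fun k => u k ^ 2) hp fun i _ => sq_nonneg _
  rw [Finset.card_range] at this
  refine this.trans (le_of_eq ?_)
  congr 1
  refine Finset.sum_congr rfl fun k _ => ?_
  rw [← sq_abs, ← Real.rpow_natCast, ← Real.rpow_mul (abs_nonneg _)]
  norm_num

theorem natCast_rpow_mul_sum_le {p h T S : ℝ} {N : ℕ} (hp : 1 ≤ p) (hh : 0 < h) (hS : 0 ≤ S)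
    (hN : N * h ≤ T) {u : ℕ → ℝ} (hu : ∀ k, u k ≤ S) :
    (N : ℝ) ^ (p - 1) * ∑ k ∈ Finset.range N, u k ≤ T ^ p * h ^ (-p) * S := by
  have h1 : ∑ k ∈ Finset.range N, u k ≤ N * S := by
    refine (Finset.sum_le_sum fun k _ => hu k).trans ?_
    simp
  have h2 : (N : ℝ) ^ (p - 1) * N = (N : ℝ) ^ p := by
    rcases Nat.eq_zero_or_pos N with rfl | h
    · simp [Real.zero_rpow (by linarith : p ≠ 0)]
    · rw [← Real.rpow_add_one (by positivity)]; ring_nf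
  have hT : 0 ≤ T := (by positivity : 0 ≤ N * h).trans hN
  calc _ ≤ (N : ℝ) ^ (p - 1) * (N * S) := by gcongr
    _ = (N : ℝ) ^ p * S := by rw [← mul_assoc, h2]
    _ ≤ (T / h) ^ p * S := by gcongr; rwa [le_div_iff₀ hh]
    _ = _ := by rw [Real.div_rpow hT hh.le, Real.rpow_neg hh.le, div_eq_mul_inv]

/-- Error bound in `L²ᵖ` for a recursion `e (n + 1) ^ 2 ≤ (A n + r₁ n + r₂ n) ^ 2` with
`A n ^ 2 ≤ (1 + κ h) * e n ^ 2` and martingale differences `r₂`. No integrability of `e` is needed. -/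
theorem exists_lintegral_partialSups_le (p κ T : ℝ) (hp : 1 ≤ p) (hκ : 0 ≤ κ) (hT : 0 ≤ T) :
    ∃ C : ℝ, 0 < C ∧ ∀ (Pr : Measure Ω) [IsProbabilityMeasure Pr] (𝓖 : Filtration ℕ mΩ) (N : ℕ)
      (h S₁ S₂ : ℝ) (e A r₁ r₂ : ℕ → Ω → ℝ), 0 < h → h ≤ 1 → N * h ≤ T →
      (∀ n, AEStronglyMeasurable[𝓖 n] (e n) Pr) → (∀ n, AEStronglyMeasurable[𝓖 n] (A n) Pr) →
      (∀ᵐ ω ∂Pr, e 0 ω = 0) →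
      (∀ᵐ ω ∂Pr, ∀ n < N, e (n + 1) ω ^ 2 ≤ (A n ω + (r₁ n ω + r₂ n ω)) ^ 2) →
      (∀ᵐ ω ∂Pr, ∀ n, A n ω ^ 2 ≤ (1 + κ * h) * e n ω ^ 2) →
      (∀ n, MemLp (r₁ n) (ENNReal.ofReal (2 * p)) Pr) → IsMartingaleDiff 𝓖 Pr (2 * p) r₂ →
      (∀ n, ∫ ω, |r₁ n ω| ^ (2 * p) ∂Pr ≤ S₁) → (∀ n, ∫ ω, |r₂ n ω| ^ (2 * p) ∂Pr ≤ S₂) →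
      ∫⁻ ω, ENNReal.ofReal ((partialSups (fun n => |e n ω|) N) ^ (2 * p)) ∂Pr
        ≤ ENNReal.ofReal (C * (h ^ (-(2 * p)) * S₁ + h ^ (-p) * S₂)) := by
  set E := Real.exp ((2 * κ + 1) * T) with hE
  set D := 1 + κ with hD
  set G := T * Real.exp ((2 * p) * (2 * p) * 2 ^ (2 * p) * T)
    * (2 * ((2 * p) * (2 * p) * 2 ^ (2 * p))) with hG
  have hE0 : 0 < E := Real.exp_pos _
  have hD0 : 0 < D := by positivity
  have hG0 : 0 ≤ G := by positivity
  set α := (16 * E ^ 2) ^ p with hα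
  set β := (6 * E) ^ p with hβ
  have hα0 : 0 ≤ α := by positivity
  have hβ0 : 0 ≤ β := by positivity
  refine ⟨3 ^ (p - 1) * (α * (4 * (G * D ^ (2 * p))) + β * T ^ p) + 1, by positivity, ?_⟩
  intro Pr _ 𝓖 N h S₁ S₂ e A r₁ r₂ hh hh1 hN hem hAm he0 hrec hAe hr₁ hr₂ hS₁ hS₂
  have hr2 : 2 ≤ 2 * p := by linarith
  have hS₁0 : 0 ≤ S₁ := (integral_nonneg fun ω => by positivity).trans (hS₁ 0)
  have hS₂0 : 0 ≤ S₂ := (integral_nonneg fun ω => by positivity).trans (hS₂ 0)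
  set a : ℕ → Ω → ℝ := fun n ω => partialSups (fun k => |e k ω|) n with ha
  set ρ := 1 + (2 * κ + 1) * h with hρ
  have hρ1 : 1 ≤ ρ := by rw [hρ]; nlinarith
  -- The weights vanish where `a` does, since `0⁻¹ = 0`; there `A` is zero as well.
  set b : ℕ → Ω → ℝ := fun n ω => (a n ω)⁻¹ * ((ρ ^ (n + 1))⁻¹ * A n ω) with hb
  have ham : ∀ n, AEStronglyMeasurable[𝓖 n] (a n) Pr := fun n =>
    aestronglyMeasurable_partialSups fun k hk =>
      aestronglyMeasurable_comp (f := e k) (g := fun x => |x|) (by fun_prop)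
        ((hem k).mono (𝓖.mono hk))
  have hbm : ∀ n, AEStronglyMeasurable[𝓖 n] (b n) Pr := fun n =>
    (aestronglyMeasurable_comp (g := fun x => x⁻¹) (by fun_prop) (ham n)).mul
      (aestronglyMeasurable_comp (g := fun x => (ρ ^ (n + 1))⁻¹ * x) (by fun_prop) (hAm n))
  have ha0 : ∀ n ω, 0 ≤ a n ω := fun n ω => partialSups_nonneg (fun k => abs_nonneg _) n
  have hea : ∀ n ω, |e n ω| ≤ a n ω := fun n ω => le_partialSups (fun k => |e k ω|) n
  have hAa : ∀ᵐ ω ∂Pr, ∀ n, |A n ω| ≤ D * a n ω := by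
    filter_upwards [hAe] with ω hω n
    have h0 := ha0 n ω
    refine abs_le_of_sq_le_sq ((hω n).trans ?_) (by positivity)
    rw [mul_pow]
    have h1 : e n ω ^ 2 ≤ a n ω ^ 2 := by
      rw [← sq_abs]; exact pow_le_pow_left₀ (abs_nonneg _) (hea n ω) 2
    have h2 : 1 + κ * h ≤ D ^ 2 := by rw [hD]; nlinarith
    gcongr
  have hbD : ∀ᵐ ω ∂Pr, ∀ n, |b n ω| ≤ D := by
    filter_upwards [hAa] with ω hω n
    have h1 : (ρ ^ (n + 1))⁻¹ ≤ 1 := inv_le_one_of_one_le₀ (one_le_pow₀ hρ1)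
    have h2 : 0 ≤ (ρ ^ (n + 1))⁻¹ := by positivity
    have h3 : 0 ≤ (a n ω)⁻¹ := inv_nonneg.2 (ha0 n ω)
    rw [hb]
    simp only
    rw [abs_mul, abs_mul, abs_of_nonneg h2, abs_of_nonneg h3]
    calc _ ≤ (a n ω)⁻¹ * (1 * (D * a n ω)) := by gcongr; exact hω n
      _ = D * ((a n ω)⁻¹ * a n ω) := by ring
      _ ≤ D * 1 := by gcongr; exact inv_mul_le_one
      _ = D := mul_one D
  have hξ := hr₂.bounded_mul (by linarith) hbm (fun k => hbD.mono fun ω hω => hω k)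
  have hr₁i : ∀ k, Integrable (fun ω => |r₁ k ω| ^ (2 * p)) Pr := fun k =>
    integrable_abs_rpow_of_memLp (by linarith) (hr₁ k)
  have hr₂i : ∀ k, Integrable (fun ω => |r₂ k ω| ^ (2 * p)) Pr := fun k =>
    integrable_abs_rpow_of_memLp (by linarith) (hr₂.memLp k)
  have hξS : ∀ k, ∫ ω, |b k ω * r₂ k ω| ^ (2 * p) ∂Pr ≤ D ^ (2 * p) * S₂ := by
    intro k
    calc _ ≤ ∫ ω, D ^ (2 * p) * |r₂ k ω| ^ (2 * p) ∂Pr := by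
          refine integral_mono_ae (integrable_abs_rpow_of_memLp (by linarith) (hξ.memLp k))
            ((hr₂i k).const_mul _) ?_
          filter_upwards [hbD] with ω hω
          rw [abs_mul, Real.mul_rpow (abs_nonneg _) (abs_nonneg _)]
          gcongr
          exact hω k
      _ ≤ _ := by
          rw [integral_const_mul]
          gcongr
          exact hS₂ k
  set s : Ω → ℝ := fun ω =>
    partialSups (fun n => |∑ k ∈ Finset.range n, b k ω * r₂ k ω| ^ p) N with hs
  have hs0 : ∀ ω, 0 ≤ s ω := fun ω => partialSups_nonneg (fun k => by positivity) N
  obtain ⟨hsi, hsI⟩ := integral_sq_partialSups_le hp hξ N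
  have hmom := integral_abs_sum_rpow_le hr2 hξ hh hh1 hξS hN
  have hsI' : ∫ ω, s ω ^ 2 ∂Pr ≤ 4 * (G * D ^ (2 * p)) * (h ^ (-p) * S₂) := by
    refine hsI.trans ((mul_le_mul_of_nonneg_left hmom (by norm_num)).trans (le_of_eq ?_))
    rw [mul_div_cancel_left₀ p two_ne_zero]
    ring
  have hpath : ∀ᵐ ω ∂Pr, a N ω ^ (2 * p) ≤ 3 ^ (p - 1) * (α * s ω ^ 2
      + β * h ^ (-p) * ((N : ℝ) ^ (p - 1) * ∑ k ∈ Finset.range N, |r₁ k ω| ^ (2 * p))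
      + β * ((N : ℝ) ^ (p - 1) * ∑ k ∈ Finset.range N, |r₂ k ω| ^ (2 * p))) := by
    filter_upwards [he0, hrec, hAe, hAa] with ω he0 hrec hAe hAa
    have hB : ∀ n ≤ N, |∑ k ∈ Finset.range n, b k ω * r₂ k ω| ≤ s ω ^ p⁻¹ := by
      intro n hn
      rw [Real.le_rpow_inv_iff_of_pos (abs_nonneg _) (hs0 ω) (by linarith)]
      exact le_partialSups_of_le (fun n => |∑ k ∈ Finset.range n, b k ω * r₂ k ω| ^ p) hn
    have hab : ∀ n < N, partialSups (fun k => |e k ω|) n * b n ω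
        = ((1 + (2 * κ + 1) * h) ^ (n + 1))⁻¹ * A n ω := by
      intro n _
      change a n ω * ((a n ω)⁻¹ * ((ρ ^ (n + 1))⁻¹ * A n ω)) = (ρ ^ (n + 1))⁻¹ * A n ω
      rcases eq_or_ne (a n ω) 0 with h0 | h0
      · have h1 := hAa n
        rw [h0, mul_zero] at h1
        rw [abs_nonpos_iff.1 h1, h0]
        simp
      · rw [mul_inv_cancel_left₀ h0]
    have h1 := sq_partialSups_abs_le (e := fun n => e n ω) (A := fun n => A n ω)
      (b := fun n => b n ω) (r₁ := fun n => r₁ n ω) (r₂ := fun n => r₂ n ω) hh hh1 hκ hN he0 hrec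
      (fun n _ => hAe n) hab hB
    have hsq : ((s ω ^ p⁻¹) ^ 2) ^ p = s ω ^ 2 := by
      rw [← Real.rpow_natCast, ← Real.rpow_mul (hs0 ω), ← Real.rpow_mul (hs0 ω),
        ← Real.rpow_natCast]
      congr 1
      field_simp
    have hc1 : 0 ≤ ∑ k ∈ Finset.range N, r₁ k ω ^ 2 := Finset.sum_nonneg fun k _ => sq_nonneg _
    have hc2 : 0 ≤ ∑ k ∈ Finset.range N, r₂ k ω ^ 2 := Finset.sum_nonneg fun k _ => sq_nonneg _
    have hc0 : 0 ≤ (s ω ^ p⁻¹) ^ 2 := sq_nonneg _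
    have hi0 : 0 ≤ h⁻¹ := by positivity
    calc a N ω ^ (2 * p) = (a N ω ^ 2) ^ p := by
          rw [Real.rpow_mul (ha0 N ω), Real.rpow_two]
      _ ≤ (16 * E ^ 2 * (s ω ^ p⁻¹) ^ 2 + 6 * E * (h⁻¹ * ∑ k ∈ Finset.range N, r₁ k ω ^ 2)
            + 6 * E * ∑ k ∈ Finset.range N, r₂ k ω ^ 2) ^ p := by
          gcongr
          refine h1.trans (le_of_eq ?_)
          ring
      _ ≤ 3 ^ (p - 1) * ((16 * E ^ 2 * (s ω ^ p⁻¹) ^ 2) ^ p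
            + (6 * E * (h⁻¹ * ∑ k ∈ Finset.range N, r₁ k ω ^ 2)) ^ p
            + (6 * E * ∑ k ∈ Finset.range N, r₂ k ω ^ 2) ^ p) :=
          add_add_rpow_le hp (by positivity) (by positivity) (by positivity)
      _ = 3 ^ (p - 1) * (α * s ω ^ 2
            + β * h ^ (-p) * (∑ k ∈ Finset.range N, r₁ k ω ^ 2) ^ p
            + β * (∑ k ∈ Finset.range N, r₂ k ω ^ 2) ^ p) := by
          have hE6 : 0 ≤ 6 * E := by positivity
          rw [Real.mul_rpow (x := 16 * E ^ 2) (by positivity) hc0, hsq,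
            Real.mul_rpow (x := 6 * E) (y := h⁻¹ * _) hE6 (by positivity), Real.mul_rpow hi0 hc1,
            Real.mul_rpow (x := 6 * E) hE6 hc2, Real.inv_rpow hh.le, ← Real.rpow_neg hh.le,
            mul_assoc β]
      _ ≤ _ := by
          gcongr
          · exact sum_sq_rpow_le hp _ N
          · exact sum_sq_rpow_le hp _ N
  have hi1 : Integrable (fun ω => α * s ω ^ 2) Pr := hsi.const_mul _
  have hi2 : Integrable (fun ω => β * h ^ (-p) *
      ((N : ℝ) ^ (p - 1) * ∑ k ∈ Finset.range N, |r₁ k ω| ^ (2 * p))) Pr :=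
    ((integrable_finsetSum _ fun k _ => hr₁i k).const_mul _).const_mul _
  have hi3 : Integrable (fun ω => β *
      ((N : ℝ) ^ (p - 1) * ∑ k ∈ Finset.range N, |r₂ k ω| ^ (2 * p))) Pr :=
    ((integrable_finsetSum _ fun k _ => hr₂i k).const_mul _).const_mul _
  have hi12 : Integrable (fun ω => α * s ω ^ 2 + β * h ^ (-p) *
      ((N : ℝ) ^ (p - 1) * ∑ k ∈ Finset.range N, |r₁ k ω| ^ (2 * p))) Pr := hi1.add hi2
  have hi : Integrable (fun ω => 3 ^ (p - 1) * (α * s ω ^ 2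
      + β * h ^ (-p) * ((N : ℝ) ^ (p - 1) * ∑ k ∈ Finset.range N, |r₁ k ω| ^ (2 * p))
      + β * ((N : ℝ) ^ (p - 1) * ∑ k ∈ Finset.range N, |r₂ k ω| ^ (2 * p)))) Pr :=
    (hi12.add hi3).const_mul _
  have hb1 := natCast_rpow_mul_sum_le hp hh hS₁0 hN hS₁
  have hb2 := natCast_rpow_mul_sum_le hp hh hS₂0 hN hS₂
  have hh2 : h ^ (-(2 * p)) = h ^ (-p) * h ^ (-p) := by
    rw [← Real.rpow_add hh]; ring_nf
  calc ∫⁻ ω, ENNReal.ofReal (a N ω ^ (2 * p)) ∂Pr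
      ≤ ∫⁻ ω, ENNReal.ofReal (3 ^ (p - 1) * (α * s ω ^ 2
        + β * h ^ (-p) * ((N : ℝ) ^ (p - 1) * ∑ k ∈ Finset.range N, |r₁ k ω| ^ (2 * p))
        + β * ((N : ℝ) ^ (p - 1) * ∑ k ∈ Finset.range N, |r₂ k ω| ^ (2 * p)))) ∂Pr := by
        refine lintegral_mono_ae ?_
        filter_upwards [hpath] with ω hω
        exact ENNReal.ofReal_le_ofReal hω
    _ = ENNReal.ofReal (∫ ω, 3 ^ (p - 1) * (α * s ω ^ 2
        + β * h ^ (-p) * ((N : ℝ) ^ (p - 1) * ∑ k ∈ Finset.range N, |r₁ k ω| ^ (2 * p))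
        + β * ((N : ℝ) ^ (p - 1) * ∑ k ∈ Finset.range N, |r₂ k ω| ^ (2 * p))) ∂Pr) := by
        refine (ofReal_integral_eq_lintegral_ofReal hi (.of_forall fun ω => ?_)).symm
        have := hs0 ω
        positivity
    _ ≤ _ := by
        refine ENNReal.ofReal_le_ofReal ?_
        rw [integral_const_mul, integral_add hi12 hi3, integral_add hi1 hi2, integral_const_mul,
          integral_const_mul, integral_const_mul, integral_const_mul, integral_const_mul,
          integral_finsetSum _ fun k _ => hr₁i k, integral_finsetSum _ fun k _ => hr₂i k]
        have hp0 : 0 ≤ h ^ (-p) := by positivity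
        calc _ ≤ 3 ^ (p - 1) * (α * (4 * (G * D ^ (2 * p)) * (h ^ (-p) * S₂))
              + β * h ^ (-p) * (T ^ p * h ^ (-p) * S₁) + β * (T ^ p * h ^ (-p) * S₂)) := by
              gcongr
          _ = 3 ^ (p - 1) * (α * (4 * (G * D ^ (2 * p))) + β * T ^ p) * (h ^ (-p) * S₂)
              + 3 ^ (p - 1) * (β * T ^ p) * (h ^ (-(2 * p)) * S₁) := by rw [hh2]; ring
          _ ≤ (3 ^ (p - 1) * (α * (4 * (G * D ^ (2 * p))) + β * T ^ p) + 1) * (h ^ (-p) * S₂)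
              + (3 ^ (p - 1) * (α * (4 * (G * D ^ (2 * p))) + β * T ^ p) + 1)
                * (h ^ (-(2 * p)) * S₁) := by
              gcongr
              · linarith
              · have : 0 ≤ 3 ^ (p - 1) * (α * (4 * (G * D ^ (2 * p)))) := by positivity
                linarith
          _ = _ := by ring

end

/-! ### Measurability of the scheme and of the remainders -/

section

variable {Ω : Type*} {mΩ : MeasurableSpace Ω}

/-- `g` need not be measurable off `(0, ∞)`; the values of `f` there occur on a null set only. -/
theorem aestronglyMeasurable_comp_of_pos {Pr : Measure Ω} {m : MeasurableSpace Ω} {f : Ω → ℝ}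
    {g : ℝ → ℝ} (hg : ContinuousOn g (Set.Ioi 0)) (hf : AEStronglyMeasurable[m] f Pr)
    (hpos : ∀ᵐ ω ∂Pr, 0 < f ω) : AEStronglyMeasurable[m] (fun ω => g (f ω)) Pr := by
  classical
  have h1 : Measurable ((Set.Ioi (0 : ℝ)).piecewise g (fun _ => 0)) :=
    hg.measurable_piecewise continuousOn_const measurableSet_Ioi
  refine (aestronglyMeasurable_comp h1 hf).congr ?_
  filter_upwards [hpos] with ω hω
  exact Set.piecewise_eq_of_mem _ _ _ hω

theorem continuousOn_of_abs_sub_le {g : ℝ → ℝ} {K : ℝ} (hK : 0 ≤ K)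
    (h : ∀ x y : ℝ, 0 < x → 0 < y → |g x - g y| ≤ K * |x - y|) : ContinuousOn g (Set.Ioi 0) := by
  refine (LipschitzOnWith.of_dist_le_mul (K := K.toNNReal) fun x hx y hy => ?_).continuousOn
  simpa [Real.dist_eq, hK] using h x y hx hy

theorem FLP.continuousOn_eval (μ : FLP) : ContinuousOn μ.eval (Set.Ioi 0) := by
  refine continuousOn_finsetSum _ fun s _ => continuousOn_const.mul ?_
  exact continuousOn_id.rpow_const fun x hx => Or.inl (ne_of_gt hx)

/-- The implicit equation of one step of the scheme has only one positive solution. -/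
theorem eq_of_eq_add_mul_inv {y d k : ℝ} (hy : 0 < y) (hk : 0 ≤ k) (h : y = d + k * y⁻¹) :
    y = (d + √(d ^ 2 + 4 * k)) / 2 := by
  have h1 : y * y = d * y + k := by
    calc y * y = (d + k * y⁻¹) * y := by rw [← h]
      _ = _ := by field_simp
  have h2 : k * y⁻¹ = y - d := by linarith
  have h3 : 0 ≤ 2 * y - d := by
    have : 0 ≤ k * y⁻¹ := by positivity
    linarith
  have h4 : d ^ 2 + 4 * k = (2 * y - d) ^ 2 := by nlinarith
  rw [h4, Real.sqrt_sq h3]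
  ring

/-- The filtration `𝓕` observed at the grid points. -/
noncomputable def gridFiltration (𝓕 : Filtration ℝ≥0 mΩ) (T : ℝ≥0) (M : ℕ) : Filtration ℕ mΩ where
  seq n := 𝓕 (gridPoint T M n)
  mono' i j hij := 𝓕.mono (by unfold gridPoint; gcongr)
  le' n := 𝓕.le _

variable {Pr : Measure Ω} {𝓕 : Filtration ℝ≥0 mΩ} {W X : ℝ≥0 → Ω → ℝ} {T : ℝ≥0} {M : ℕ}
  {μ : FLP} {σ c : ℝ} {P : ℝ → ℝ → ℝ}

/-- The equation for `X` turns the integral in the remainder into increments of `X` and `W`. -/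
theorem remainder_ae_eq (hX : IsPositiveSolution μ.eval σ W X 𝓕 Pr) (n : ℕ) :
    ∀ᵐ ω ∂Pr, remainder T M P μ c X n ω = X (gridPoint T M (n + 1)) ω
      - P (stepSize T M) (X (gridPoint T M n) ω)
      - c * stepSize T M * (X (gridPoint T M (n + 1)) ω)⁻¹
      - modifiedDrift μ c (P (stepSize T M) (X (gridPoint T M n) ω)) * stepSize T M
      - σ * (W (gridPoint T M (n + 1)) ω - W (gridPoint T M n) ω) := by
  filter_upwards [hX.continuous_paths, hX.positive, hX.equation] with ω hc hp he
  have hcont : Continuous fun s : ℝ => μ.eval (X s.toNNReal ω) := by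
    refine μ.continuousOn_eval.comp_continuous (hc.comp continuous_real_toNNReal) fun s => hp _
  have h1 := he (gridPoint T M n)
  have h2 := he (gridPoint T M (n + 1))
  have h3 := intervalIntegral.integral_add_adjacent_intervals
    (hcont.intervalIntegrable (μ := volume) 0 (gridPoint T M n))
    (hcont.intervalIntegrable (gridPoint T M n) (gridPoint T M (n + 1)))
  unfold remainder
  linarith

/-- The numerical solution is adapted, because one step of the scheme determines `Y (n + 1)` from
`Y n` and the increment of `W`. -/
theorem aestronglyMeasurable_numericalSolution (hc : 0 ≤ c)
    (hW : Adapted 𝓕 W) (hX : IsPositiveSolution μ.eval σ W X 𝓕 Pr)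
    (hP : ContinuousOn (P (stepSize T M)) (Set.Ioi 0))
    (hμP : ContinuousOn (fun x => modifiedDrift μ c (P (stepSize T M) x)) (Set.Ioi 0))
    {Y : ℕ → Ω → ℝ} (hY : IsNumericalSolution T M P μ c σ W X Pr Y) :
    ∀ n ≤ M, AEStronglyMeasurable[gridFiltration 𝓕 T M n] (Y n) Pr := by
  have hh : 0 ≤ stepSize T M := by unfold stepSize; positivity
  intro n
  induction n with
  | zero =>
    intro _
    have h1 : AEStronglyMeasurable[gridFiltration 𝓕 T M 0] (X 0) Pr :=
      ((hX.adapted 0).mono (𝓕.mono zero_le) le_rfl).stronglyMeasurable.aestronglyMeasurable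
    exact h1.congr (hY.initial.mono fun ω h => h.symm)
  | succ n ih =>
    intro hn
    have hle : gridFiltration 𝓕 T M n ≤ gridFiltration 𝓕 T M (n + 1) :=
      (gridFiltration 𝓕 T M).mono (Nat.le_succ n)
    have h1 := (ih (by omega)).mono hle
    have hpos : ∀ᵐ ω ∂Pr, 0 < Y n ω := hY.positive.mono fun ω h => h n (by omega)
    have h2 := aestronglyMeasurable_comp_of_pos hP h1 hpos
    have h3 := aestronglyMeasurable_comp_of_pos hμP h1 hpos
    have hW0 : AEStronglyMeasurable[gridFiltration 𝓕 T M (n + 1)] (W (gridPoint T M n)) Pr :=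
      ((hW (gridPoint T M n)).mono hle le_rfl).stronglyMeasurable.aestronglyMeasurable
    have hW1 : AEStronglyMeasurable[gridFiltration 𝓕 T M (n + 1)] (W (gridPoint T M (n + 1))) Pr :=
      (hW (gridPoint T M (n + 1))).stronglyMeasurable.aestronglyMeasurable
    have hd := (h2.add (h3.mul_const (stepSize T M))).add ((hW1.sub hW0).const_mul σ)
    refine (aestronglyMeasurable_comp (g := fun d => (d + √(d ^ 2 + 4 * (c * stepSize T M))) / 2)
      (by fun_prop) hd).congr ?_
    filter_upwards [hY.positive, hY.step] with ω hp hs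
    refine (eq_of_eq_add_mul_inv (hp _ hn) (by positivity) ?_).symm
    have h4 := hs n (by omega)
    simp only [Pi.add_apply, Pi.sub_apply]
    linarith

theorem aestronglyMeasurable_remainder (hW : Adapted 𝓕 W)
    (hX : IsPositiveSolution μ.eval σ W X 𝓕 Pr)
    (hP : ContinuousOn (P (stepSize T M)) (Set.Ioi 0))
    (hμP : ContinuousOn (fun x => modifiedDrift μ c (P (stepSize T M) x)) (Set.Ioi 0)) (n : ℕ) :
    AEStronglyMeasurable[gridFiltration 𝓕 T M (n + 1)] (remainder T M P μ c X n) Pr := by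
  have hle : gridFiltration 𝓕 T M n ≤ gridFiltration 𝓕 T M (n + 1) :=
    (gridFiltration 𝓕 T M).mono (Nat.le_succ n)
  have hX0 : AEStronglyMeasurable[gridFiltration 𝓕 T M (n + 1)] (X (gridPoint T M n)) Pr :=
    ((hX.adapted (gridPoint T M n)).mono hle le_rfl).stronglyMeasurable.aestronglyMeasurable
  have hX1 : AEStronglyMeasurable[gridFiltration 𝓕 T M (n + 1)] (X (gridPoint T M (n + 1))) Pr :=
    (hX.adapted (gridPoint T M (n + 1))).stronglyMeasurable.aestronglyMeasurable
  have hW0 : AEStronglyMeasurable[gridFiltration 𝓕 T M (n + 1)] (W (gridPoint T M n)) Pr :=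
    ((hW (gridPoint T M n)).mono hle le_rfl).stronglyMeasurable.aestronglyMeasurable
  have hW1 : AEStronglyMeasurable[gridFiltration 𝓕 T M (n + 1)] (W (gridPoint T M (n + 1))) Pr :=
    (hW (gridPoint T M (n + 1))).stronglyMeasurable.aestronglyMeasurable
  have hpos : ∀ᵐ ω ∂Pr, 0 < X (gridPoint T M n) ω := hX.positive.mono fun ω h => h _
  have h2 := aestronglyMeasurable_comp_of_pos hP hX0 hpos
  have h3 := aestronglyMeasurable_comp_of_pos hμP hX0 hpos
  have h4 := aestronglyMeasurable_comp (g := fun x => c * stepSize T M * x⁻¹) (by fun_prop) hX1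
  refine ((((hX1.sub h2).sub h4).sub (h3.mul_const (stepSize T M))).sub
    ((hW1.sub hW0).const_mul σ)).congr ?_
  filter_upwards [remainder_ae_eq hX n] with ω hω
  exact hω.symm

theorem memLp_of_lintegral_ne_top {f : Ω → ℝ} {r : ℝ} (hr : 0 < r)
    (hf : AEStronglyMeasurable f Pr) (h : ∫⁻ ω, ENNReal.ofReal (|f ω| ^ r) ∂Pr ≠ ∞) :
    MemLp f (ENNReal.ofReal r) Pr := by
  refine ⟨hf, ?_⟩
  rw [eLpNorm_lt_top_iff_lintegral_rpow_enorm_lt_top (by simpa using hr) (by simp),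
    ENNReal.toReal_ofReal hr.le]
  refine lt_of_eq_of_lt (lintegral_congr fun ω => ?_) (lt_top_iff_ne_top.2 h)
  rw [Real.enorm_eq_ofReal_abs, ENNReal.ofReal_rpow_of_nonneg (abs_nonneg _) hr.le]

theorem integral_abs_rpow_condExp_le [IsProbabilityMeasure Pr] {m : MeasurableSpace Ω} {f : Ω → ℝ}
    {r : ℝ} {S : ℝ≥0∞} (hr : 1 ≤ r) (hf : MemLp f (ENNReal.ofReal r) Pr) (hS : S ≠ ∞)
    (h : ∫⁻ ω, ENNReal.ofReal (|f ω| ^ r) ∂Pr ≤ S) :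
    ∫ ω, |Pr[f | m] ω| ^ r ∂Pr ≤ S.toReal := by
  have hi := integrable_abs_rpow_of_memLp (by linarith) hf
  have h1 := integral_norm_condExp_rpow_le (m := m) hr (f := f) (by simpa using hi)
  simp only [Real.norm_eq_abs] at h1
  calc _ ≤ ∫ ω, |f ω| ^ r ∂Pr := h1
    _ = (∫⁻ ω, ENNReal.ofReal (|f ω| ^ r) ∂Pr).toReal :=
      integral_eq_lintegral_of_nonneg_ae (.of_forall fun ω => by positivity) hi.aestronglyMeasurable
    _ ≤ _ := ENNReal.toReal_mono hS h

end

end AdditiveNoise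

/-! ### The error of the numerical scheme -/

theorem theorem4p1 {Ω : Type*} [mΩ : MeasurableSpace Ω] (Pr : Measure Ω) [IsProbabilityMeasure Pr]
    (𝓕 : Filtration ℝ≥0 mΩ) (W X : ℝ≥0 → Ω → ℝ)
    (T : ℝ≥0) (hT : 0 < T)
    (μ : AdditiveNoise.FLP) (σ c : ℝ) (hσ : σ ≠ 0) (hc : 0 < c)
    (P : ℝ → ℝ → ℝ) (m₁ m₂ : ℝ) (hm₁ : 0 ≤ m₁) (hm₂ : 0 ≤ m₂)
    (pstar : ℝ≥0∞) (hpstar : 2 < pstar)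
    (hW : AdditiveNoise.IsBrownianRelative W 𝓕 Pr)
    (hX : AdditiveNoise.IsPositiveSolution μ.eval σ W X 𝓕 Pr)
    (hμ : AdditiveNoise.OneSidedLipschitz μ.eval)
    (hinv : AdditiveNoise.InverseMomentsBounded T X Pr pstar)
    (hμhat : AdditiveNoise.OneSidedLipschitz (AdditiveNoise.modifiedDrift μ c))
    (hP : AdditiveNoise.CorrectionMap T P m₁ m₂)
    (hμP : AdditiveNoise.CorrectedDriftBound T P (AdditiveNoise.modifiedDrift μ c))
    (p : ℝ) (hp₁ : 1 ≤ p)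
    (hp₂ : ENNReal.ofReal p ≤
      min (pstar / ENNReal.ofReal (-(2 * μ.degMinus))) (pstar / ENNReal.ofReal (2 * m₁))) :
    ∃ C : ℝ, 0 < C ∧ ∀ M : ℕ, AdditiveNoise.Admissible T M →
      ∀ Y : ℕ → Ω → ℝ, AdditiveNoise.IsNumericalSolution T M P μ c σ W X Pr Y →
      ∀ R₁ R₂ : ℕ → Ω → ℝ, AdditiveNoise.IsRemainderDecomposition T M P μ c X 𝓕 Pr R₁ R₂ →
        (∫⁻ ω, ⨆ n ∈ Finset.range (M + 1),
            ENNReal.ofReal (|X (AdditiveNoise.gridPoint T M n) ω - Y n ω| ^ (2 * p)) ∂Pr)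
          ≤ ENNReal.ofReal C *
            (ENNReal.ofReal (1 / AdditiveNoise.stepSize T M ^ (2 * p)) *
                (⨆ n ∈ Finset.Icc 1 M, ∫⁻ ω, ENNReal.ofReal (|R₁ n ω| ^ (2 * p)) ∂Pr)
              + ENNReal.ofReal (1 / AdditiveNoise.stepSize T M ^ p) *
                (⨆ n ∈ Finset.Icc 1 M, ∫⁻ ω, ENNReal.ofReal (|R₂ n ω| ^ (2 * p)) ∂Pr)) := by
  open AdditiveNoise in
  obtain ⟨L, hL, hLip⟩ := hμhat
  obtain ⟨C₁, hC₁, hP⟩ := hP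
  obtain ⟨C₂, hC₂, hμP⟩ := hμP
  obtain ⟨C, hC, hmain⟩ := exists_lintegral_partialSups_le (mΩ := mΩ) p (2 * L + C₂ ^ 2) T hp₁
    (by positivity) T.2
  refine ⟨C, hC, fun M hM Y hY R₁ R₂ hR => ?_⟩
  obtain ⟨hPpos, hPlip, -⟩ := hP M hM
  obtain ⟨-, hglip⟩ := hμP M hM
  have hM0 : (0 : ℝ) < M := by exact_mod_cast hM.1
  have hh : 0 < stepSize T M := by
    have : (0 : ℝ) < T := hT
    unfold stepSize; positivity
  have hh1 := hM.2
  have hN : M * stepSize T M ≤ T := by unfold stepSize; field_simp; rfl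
  set h := stepSize T M with hdef
  set S₁ := ⨆ n ∈ Finset.Icc 1 M, ∫⁻ ω, ENNReal.ofReal (|R₁ n ω| ^ (2 * p)) ∂Pr with hS₁
  set S₂ := ⨆ n ∈ Finset.Icc 1 M, ∫⁻ ω, ENNReal.ofReal (|R₂ n ω| ^ (2 * p)) ∂Pr with hS₂
  have hw₁ : ENNReal.ofReal (1 / h ^ (2 * p)) ≠ 0 := by
    rw [ne_eq, ENNReal.ofReal_eq_zero, not_le]; positivity
  have hw₂ : ENNReal.ofReal (1 / h ^ p) ≠ 0 := by
    rw [ne_eq, ENNReal.ofReal_eq_zero, not_le]; positivity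
  have hCne : ENNReal.ofReal C ≠ 0 := by
    rw [ne_eq, ENNReal.ofReal_eq_zero, not_le]; exact hC
  rcases eq_or_ne S₁ ∞ with hS₁t | hS₁t
  · rw [hS₁t, ENNReal.mul_top hw₁, top_add, ENNReal.mul_top hCne]; exact le_top
  rcases eq_or_ne S₂ ∞ with hS₂t | hS₂t
  · rw [hS₂t, ENNReal.mul_top hw₂, add_top, ENNReal.mul_top hCne]; exact le_top
  have hr0 : 0 < 2 * p := by linarith
  have hr1 : 1 ≤ 2 * p := by linarith
  have hPc : ContinuousOn (P h) (Set.Ioi 0) :=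
    continuousOn_of_abs_sub_le zero_le_one fun x y hx hy => by simpa using hPlip x y hx hy
  have hgc : ContinuousOn (fun x => modifiedDrift μ c (P h x)) (Set.Ioi 0) :=
    continuousOn_of_abs_sub_le (by positivity) hglip
  set 𝓖 := gridFiltration 𝓕 T M with h𝓖
  have hRm : ∀ n, AEStronglyMeasurable[𝓖 (n + 1)] (remainder T M P μ c X n) Pr :=
    aestronglyMeasurable_remainder hW.adapted hX hPc hgc
  have hle₁ : ∀ n < M, ∫⁻ ω, ENNReal.ofReal (|R₁ (n + 1) ω| ^ (2 * p)) ∂Pr ≤ S₁ := fun n hn =>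
    le_iSup₂_of_le (f := fun n (_ : n ∈ Finset.Icc 1 M) =>
      ∫⁻ ω, ENNReal.ofReal (|R₁ n ω| ^ (2 * p)) ∂Pr) (n + 1) (by simp; omega) le_rfl
  have hle₂ : ∀ n < M, ∫⁻ ω, ENNReal.ofReal (|R₂ (n + 1) ω| ^ (2 * p)) ∂Pr ≤ S₂ := fun n hn =>
    le_iSup₂_of_le (f := fun n (_ : n ∈ Finset.Icc 1 M) =>
      ∫⁻ ω, ENNReal.ofReal (|R₂ n ω| ^ (2 * p)) ∂Pr) (n + 1) (by simp; omega) le_rfl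
  have hL₂ : ∀ n < M, MemLp (R₂ (n + 1)) (ENNReal.ofReal (2 * p)) Pr := fun n hn =>
    memLp_of_lintegral_ne_top hr0 (hR.integrable n hn).aestronglyMeasurable
      (ne_top_of_le_ne_top hS₂t (hle₂ n hn))
  have hL₁ : ∀ n < M, MemLp (R₁ (n + 1)) (ENNReal.ofReal (2 * p)) Pr := fun n hn => by
    refine memLp_of_lintegral_ne_top hr0 ?_ (ne_top_of_le_ne_top hS₁t (hle₁ n hn))
    refine (((hRm n).mono (𝓖.le _)).sub (hR.integrable n hn).aestronglyMeasurable).congr ?_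
    filter_upwards [hR.sum_eq n hn] with ω hω
    simp [hω]
  have hone : (1 : ℝ≥0∞) ≤ ENNReal.ofReal (2 * p) := ENNReal.one_le_ofReal.2 hr1
  -- `R₂` need not be adapted: both parts are projected onto the information at the next grid point.
  set r₁ : ℕ → Ω → ℝ := fun n => if n < M then Pr[R₁ (n + 1) | 𝓖 (n + 1)] else 0 with hr₁
  set r₂ : ℕ → Ω → ℝ := fun n => if n < M then Pr[R₂ (n + 1) | 𝓖 (n + 1)] else 0 with hr₂
  have hsum : ∀ᵐ ω ∂Pr, ∀ n < M, r₁ n ω + r₂ n ω = remainder T M P μ c X n ω := by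
    refine ae_all_iff.2 fun n => ?_
    by_cases hn : n < M
    · have hi₁ := (hL₁ n hn).integrable hone
      have h1 : Pr[R₁ (n + 1) + R₂ (n + 1) | 𝓖 (n + 1)] =ᵐ[Pr]
          Pr[remainder T M P μ c X n | 𝓖 (n + 1)] :=
        condExp_congr_ae ((hR.sum_eq n hn).mono fun ω hω => hω.symm)
      have h2 := condExp_of_aestronglyMeasurable' (𝓖.le (n + 1)) (hRm n)
        ((hi₁.add (hR.integrable n hn)).congr ((hR.sum_eq n hn).mono fun ω hω => hω.symm))
      have h3 := condExp_add hi₁ (hR.integrable n hn) (𝓖 (n + 1))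
      filter_upwards [h1, h2, h3] with ω h1 h2 h3 _
      simp only [hr₁, hr₂, if_pos hn]
      rw [← h2, ← h1, h3]
      rfl
    · exact .of_forall fun ω h => absurd h hn
  have hr₁L : ∀ n, MemLp (r₁ n) (ENNReal.ofReal (2 * p)) Pr := fun n => by
    by_cases hn : n < M
    · simp only [hr₁, if_pos hn]; exact (hL₁ n hn).condExp hone
    · simp only [hr₁, if_neg hn]; exact MemLp.zero
  have hr₂D : IsMartingaleDiff 𝓖 Pr (2 * p) r₂ := by
    refine ⟨fun n => ?_, fun n => ?_, fun n => ?_⟩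
    · by_cases hn : n < M
      · simp only [hr₂, if_pos hn]
        exact stronglyMeasurable_condExp.aestronglyMeasurable
      · simp only [hr₂, if_neg hn]; exact aestronglyMeasurable_const
    · by_cases hn : n < M
      · simp only [hr₂, if_pos hn]; exact (hL₂ n hn).condExp hone
      · simp only [hr₂, if_neg hn]; exact MemLp.zero
    · by_cases hn : n < M
      · simp only [hr₂, if_pos hn]
        exact (condExp_condExp_of_le (𝓖.mono (Nat.le_succ n)) (𝓖.le _)).trans
          (hR.condExp_eq_zero n hn)
      · simp only [hr₂, if_neg hn]
        rw [condExp_zero]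
  have hr₁S : ∀ n, ∫ ω, |r₁ n ω| ^ (2 * p) ∂Pr ≤ S₁.toReal := fun n => by
    by_cases hn : n < M
    · simp only [hr₁, if_pos hn]
      exact integral_abs_rpow_condExp_le hr1 (hL₁ n hn) hS₁t (hle₁ n hn)
    · simp [hr₁, if_neg hn, Real.zero_rpow hr0.ne']
  have hr₂S : ∀ n, ∫ ω, |r₂ n ω| ^ (2 * p) ∂Pr ≤ S₂.toReal := fun n => by
    by_cases hn : n < M
    · simp only [hr₂, if_pos hn]
      exact integral_abs_rpow_condExp_le hr1 (hL₂ n hn) hS₂t (hle₂ n hn)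
    · simp [hr₂, if_neg hn, Real.zero_rpow hr0.ne']
  have hYm := aestronglyMeasurable_numericalSolution hc.le hW.adapted hX hPc hgc hY
  have hXm : ∀ n, AEStronglyMeasurable[𝓖 n] (X (gridPoint T M n)) Pr := fun n =>
    (hX.adapted (gridPoint T M n)).stronglyMeasurable.aestronglyMeasurable
  set e : ℕ → Ω → ℝ := fun n =>
    if n ≤ M then fun ω => X (gridPoint T M n) ω - Y n ω else 0 with he
  set A : ℕ → Ω → ℝ := fun n => if n < M then fun ω =>
    (P h (X (gridPoint T M n) ω) - P h (Y n ω)) + h *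
      (modifiedDrift μ c (P h (X (gridPoint T M n) ω)) - modifiedDrift μ c (P h (Y n ω)))
    else 0 with hA
  have hem : ∀ n, AEStronglyMeasurable[𝓖 n] (e n) Pr := fun n => by
    by_cases hn : n ≤ M
    · simp only [he, if_pos hn]; exact (hXm n).sub (hYm n hn)
    · simp only [he, if_neg hn]; exact aestronglyMeasurable_const
  have hAm : ∀ n, AEStronglyMeasurable[𝓖 n] (A n) Pr := fun n => by
    by_cases hn : n < M
    · simp only [hA, if_pos hn]
      have hXp : ∀ᵐ ω ∂Pr, 0 < X (gridPoint T M n) ω := hX.positive.mono fun ω h => h _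
      have hYp : ∀ᵐ ω ∂Pr, 0 < Y n ω := hY.positive.mono fun ω h => h n hn.le
      exact ((aestronglyMeasurable_comp_of_pos hPc (hXm n) hXp).sub
        (aestronglyMeasurable_comp_of_pos hPc (hYm n hn.le) hYp)).add
        (((aestronglyMeasurable_comp_of_pos hgc (hXm n) hXp).sub
          (aestronglyMeasurable_comp_of_pos hgc (hYm n hn.le) hYp)).const_mul h)
    · simp only [hA, if_neg hn]; exact aestronglyMeasurable_const
  have he0 : ∀ᵐ ω ∂Pr, e 0 ω = 0 := by
    filter_upwards [hY.initial] with ω hω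
    simp [he, hω, gridPoint]
  have hrec : ∀ᵐ ω ∂Pr, ∀ n < M, e (n + 1) ω ^ 2 ≤ (A n ω + (r₁ n ω + r₂ n ω)) ^ 2 := by
    filter_upwards [hX.positive, hY.positive, hY.step, hsum,
      ae_all_iff.2 (remainder_ae_eq (P := P) (c := c) (T := T) (M := M) hX)]
      with ω hXp hYp hYs hs hrem n hn
    have h1 := hrem n
    rw [← hs n hn] at h1
    have h2 := hYs n hn
    simp only [he, hA, if_pos hn, if_pos (show n + 1 ≤ M from hn)]
    refine sq_sub_le_of_implicit (k := c * h) (hXp _) (hYp _ hn) (by positivity) ?_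
    rw [h1]
    linarith
  have hAe : ∀ᵐ ω ∂Pr, ∀ n, A n ω ^ 2 ≤ (1 + (2 * L + C₂ ^ 2) * h) * e n ω ^ 2 := by
    filter_upwards [hX.positive, hY.positive] with ω hXp hYp n
    by_cases hn : n < M
    · simp only [he, hA, if_pos hn, if_pos hn.le]
      have hx := hXp (gridPoint T M n)
      have hy := hYp n hn.le
      exact sq_explicit_le hh hL.le (hPlip _ _ hx hy) (hLip _ _ (hPpos _ hx) (hPpos _ hy))
        (hglip _ _ hx hy)
    · simp only [hA, if_neg hn, Pi.zero_apply]
      rw [zero_pow two_ne_zero]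
      positivity
  have hfin := hmain Pr 𝓖 M h S₁.toReal S₂.toReal e A r₁ r₂ hh hh1 hN hem hAm he0 hrec hAe hr₁L
    hr₂D hr₁S hr₂S
  calc _ ≤ ∫⁻ ω, ENNReal.ofReal ((partialSups (fun n => |e n ω|) M) ^ (2 * p)) ∂Pr := by
        refine lintegral_mono fun ω => iSup₂_le fun n hn => ENNReal.ofReal_le_ofReal ?_
        have hn' : n ≤ M := Nat.lt_succ_iff.1 (Finset.mem_range.1 hn)
        have h1 := le_partialSups_of_le (fun n => |e n ω|) hn'
        simp only [he, if_pos hn'] at h1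
        exact Real.rpow_le_rpow (abs_nonneg _) h1 hr0.le
    _ ≤ _ := hfin
    _ = _ := by
        rw [ENNReal.ofReal_mul hC.le, ENNReal.ofReal_add (by positivity) (by positivity),
          ENNReal.ofReal_mul (by positivity), ENNReal.ofReal_mul (by positivity),
          ENNReal.ofReal_toReal hS₁t, ENNReal.ofReal_toReal hS₂t, Real.rpow_neg hh.le,
          Real.rpow_neg hh.le, one_div, one_div]
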